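/- Notation. $(a)_k=a(a+1)\cdots(a+k-1)$; $${}_pF_q\!\left({a_1,\dots,a_p\atop b_1,\dots,b_q};z\right)=\sum_{n\ge0}\frac{(a_1)_n\cdots(a_p)_n}{(b_1)_n\cdots(b_q)_n}\frac{z^n}{n!},$$ $$\Theta(k)=\frac{\prod_{i=1}^r\Gamma(\alpha_i+kA_i)}{\prod_{j=1}^s\Gamma(\beta_j+kB_j)},\qquad {}_r\Psi_s\!\left[{(\alpha_1,A_1),\dots,(\alpha_r,A_r)\atop(\beta_1,B_1),\dots,(\beta_s,B_s)};z\right]=\sum_{k\ge0}\Theta(k)\frac{z^k}{k!};$$ $\Delta(2;l)$ is the array $\frac l2,\frac{l+1}2$, and for $0\le j\le 3$, $\Delta^*(4;1+j)$ is the array $\frac{j+1}4,\frac{j+2}4,\frac{j+3}4,\frac{j+4}4$ with its entry $\frac44$ omitted. Put $$\Delta^*=\sum_j B_j-\sum_i A_i,\quad \delta^*=\prod_i|A_i|^{-A_i}\prod_j|B_j|^{B_j},\quad \mu^*=\sum_j\beta_j-\sum_i\alpha_i+\tfrac{r-s}2 .$$ Let $\upsilon\in\mathbb C$ with $\mathrm{Re}(\upsilon)>0$,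 let $c>0$, $y>0$, and let $\lambda,b$ be real, either both positive or both negative. For $k\ge 0$ put $$S_k=\sum_{j=0}^{3}\frac{(-1)^j(\lambda b+ck)^j\,\Gamma(\upsilon+\frac j2)}{y^{j/2}\,j!}\cos\!\left(\frac{\upsilon\pi}2+\frac{j\pi}4\right){}_2F_3\!\left({\Delta(2;\frac{2\upsilon+j}2)\atop\Delta^*(4;1+j)};\ \frac{-1}{64y^2}\left\{\frac{\lambda b\,(\frac{\lambda b+c}{c})_k}{(\frac{\lambda b}{c})_k}\right\}^4\right).$$ The series of these ${}_2F_3$ converge for every value of the argument. (1) Let $r,s\ge0$, $\alpha_i,\beta_j\in\mathbb C$ and $A_i,B_j\in\mathbb R\setminus\{0\}$, where no number $\alpha_i+kA_i$ or $\beta_j+kB_j$ $(k=0,1,2,\dots)$ is a pole of $\Gamma$. Assume (a) or (b): (a) for every $i$ with $A_i<0$ the numbers $\alpha_i+kA_i$ $(k\ge0)$ have a positive distance from $\{0,-1,-2,\dots\}$, and one of the following holds: $\Delta^*>-1$; or $\Delta^*=-1$ and $\delta^*>1$; or $\Delta^*=-1$, $\delta^*=1$ and $2\,\mathrm{Re}(\upsilon)+\mathrm{Re}(\mu^*)>\frac12$;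 (b) $\displaystyle\sum_{k\ge0}\frac{|\Theta(k)|}{k!}(k+1)^{-2\mathrm{Re}(\upsilon)}<\infty$ (for instance, ${}_r\Psi_s$ converges absolutely at $z=1$). Then the series of ${}_r\Psi_s$ converges absolutely at $e^{-c\sqrt x}$ for every $x>0$, the integrand below is Lebesgue integrable on $(0,\infty)$, the series over $k$ converges absolutely, and $$\mathbf J_C(\upsilon,b,c,\lambda,y):=\int_0^\infty x^{\upsilon-1}e^{-b\lambda\sqrt x}\,{}_r\Psi_s\!\left[{(\alpha_1,A_1),\dots,(\alpha_r,A_r)\atop(\beta_1,B_1),\dots,(\beta_s,B_s)};e^{-c\sqrt x}\right]\cos(xy)\,dx=y^{-\upsilon}\sum_{k=0}^\infty\frac{\Theta(k)}{k!}\,S_k .$$ (2) Let $r\le s+1$, $\alpha_i\in\mathbb C$ and $\beta_j\in\mathbb C\setminus\{0,-1,-2,\dots\}$. If $r=s+1$, assume moreover that $\mathrm{Re}\big(2\upsilon+\sum_j\beta_j-\sum_i\alpha_i\big)>0$ or that some $\alpha_i\in\{0,-1,-2,\dots\}$. Then the series of ${}_rF_s$ converges absolutely at $e^{-c\sqrt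 x}$ for every $x>0$, the integrand below is Lebesgue integrable on $(0,\infty)$, the series over $k$ converges absolutely, and $$\mathbf K_C(\upsilon,b,c,\lambda,y):=\int_0^\infty x^{\upsilon-1}e^{-b\lambda\sqrt x}\,{}_rF_s\!\left({\alpha_1,\dots,\alpha_r\atop\beta_1,\dots,\beta_s};e^{-c\sqrt x}\right)\cos(xy)\,dx=y^{-\upsilon}\sum_{k=0}^\infty\frac{(\alpha_1)_k\cdots(\alpha_r)_k}{(\beta_1)_k\cdots(\beta_s)_k\,k!}\,S_k .$$ (3) If no $\alpha_i$ and no $\beta_j$ lies in $\{0,-1,-2,\dots\}$, then for $A_1=\dots=A_r=B_1=\dots=B_s=1$ one has $$\mathbf J_C(\upsilon,b,c,\lambda,y)=\frac{\Gamma(\alpha_1)\cdots\Gamma(\alpha_r)}{\Gamma(\beta_1)\cdots\Gamma(\beta_s)}\,\mathbf K_C(\upsilon,b,c,\lambda,y).$$ -/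

import Mathlib

open scoped BigOperators

noncomputable section

/-- The shifted factorial `(a)_n = a (a+1) ⋯ (a+n-1)`. -/
def poch (a : ℂ) (n : ℕ) : ℂ := (ascPochhammer ℂ n).eval a

/-- The `n`-th term of the series of the generalized hypergeometric function `ₚF_q`. -/
def pFqTerm {p q : ℕ} (a : Fin p → ℂ) (b : Fin q → ℂ) (z : ℂ) (n : ℕ) : ℂ :=
  (∏ i, poch (a i) n) / (∏ j, poch (b j) n) * (z ^ n / (n.factorial : ℂ))

/-- The generalized hypergeometric function `ₚF_q(a; b; z)`, as the sum of its series. -/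
def pFq {p q : ℕ} (a : Fin p → ℂ) (b : Fin q → ℂ) (z : ℂ) : ℂ :=
  ∑' n : ℕ, pFqTerm a b z n

/-- `Θ(k) = ∏ Γ(αᵢ + k Aᵢ) / ∏ Γ(βⱼ + k Bⱼ)`. -/
def foxWrightCoeff {r s : ℕ} (α : Fin r → ℂ) (A : Fin r → ℝ) (β : Fin s → ℂ) (B : Fin s → ℝ)
    (k : ℕ) : ℂ :=
  (∏ i, Complex.Gamma (α i + (k : ℂ) * (A i : ℂ))) /
    (∏ j, Complex.Gamma (β j + (k : ℂ) * (B j : ℂ)))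

/-- The `k`-th term of the series of the Fox–Wright function `ᵣΨₛ`. -/
def foxWrightTerm {r s : ℕ} (α : Fin r → ℂ) (A : Fin r → ℝ) (β : Fin s → ℂ) (B : Fin s → ℝ)
    (z : ℂ) (k : ℕ) : ℂ :=
  foxWrightCoeff α A β B k * (z ^ k / (k.factorial : ℂ))

/-- The Fox–Wright psi function `ᵣΨₛ[(α, A); (β, B); z]`, as the sum of its series. -/
def foxWright {r s : ℕ} (α : Fin r → ℂ) (A : Fin r → ℝ) (β : Fin s → ℂ) (B : Fin s → ℝ)
    (z : ℂ) : ℂ :=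
  ∑' k : ℕ, foxWrightTerm α A β B z k

/-- All the numbers `aᵢ + k Aᵢ` (`k = 0, 1, 2, …`) avoid the poles `0, -1, -2, …` of `Γ`. -/
def GammaDefined {m : ℕ} (a : Fin m → ℂ) (A : Fin m → ℝ) : Prop :=
  ∀ (i : Fin m) (k n : ℕ), a i + (k : ℂ) * (A i : ℂ) ≠ -(n : ℂ)

/-- For each negative coefficient `Aᵢ`, the numbers `aᵢ + k Aᵢ` stay at a positive distance from
the poles of `Γ`. For positive coefficients this already follows from `GammaDefined`. -/
def AwayFromPoles {m : ℕ} (a : Fin m → ℂ) (A : Fin m → ℝ) : Prop :=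
  ∀ i : Fin m, A i < 0 →
    ∃ ε : ℝ, 0 < ε ∧ ∀ k n : ℕ, ε ≤ ‖a i + (k : ℂ) * (A i : ℂ) + (n : ℂ)‖

/-- `Δ* = ∑ Bⱼ - ∑ Aᵢ`. -/
def fwDelta {r s : ℕ} (A : Fin r → ℝ) (B : Fin s → ℝ) : ℝ := ∑ j, B j - ∑ i, A i

/-- `δ* = ∏ |Aᵢ|^(-Aᵢ) ∏ |Bⱼ|^(Bⱼ)`. -/
def fwRadius {r s : ℕ} (A : Fin r → ℝ) (B : Fin s → ℝ) : ℝ :=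
  (∏ i, |A i| ^ (-A i)) * ∏ j, |B j| ^ B j

/-- `μ* = ∑ βⱼ - ∑ αᵢ + (r - s)/2`. -/
def fwMu {r s : ℕ} (α : Fin r → ℂ) (β : Fin s → ℂ) : ℂ :=
  ∑ j, β j - ∑ i, α i + ((r : ℂ) - (s : ℂ)) / 2

/-- The parameter conditions under which the Fox–Wright series converges at `e^{-c√x}` for every
`x > 0` and (in the boundary case `Δ* = -1`, `δ* = 1`) the singularity at `x = 0` is integrable
against `x^(υ-1)`. -/
def FoxWrightConditions {r s : ℕ} (υ : ℂ) (α : Fin r → ℂ) (A : Fin r → ℝ) (β : Fin s → ℂ)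
    (B : Fin s → ℝ) : Prop :=
  AwayFromPoles α A ∧
    (-1 < fwDelta A B ∨
      (fwDelta A B = -1 ∧ 1 < fwRadius A B) ∨
      (fwDelta A B = -1 ∧ fwRadius A B = 1 ∧ 1 / 2 < 2 * υ.re + (fwMu α β).re))

/-- Direct form of a convergence condition: `∑ |Θ(k)|/k! (k+1)^(-2 Re υ) < ∞`. It holds in
particular whenever `ᵣΨₛ` converges absolutely at `1` and `Re υ > 0`. -/
def FoxWrightSummable {r s : ℕ} (υ : ℂ) (α : Fin r → ℂ) (A : Fin r → ℝ) (β : Fin s → ℂ)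
    (B : Fin s → ℝ) : Prop :=
  Summable fun k : ℕ =>
    ‖foxWrightCoeff α A β B k‖ / (k.factorial : ℝ) * ((k : ℝ) + 1) ^ (-2 * υ.re)

/-- The array `Δ(N; l) = (l/N, (l+1)/N, …, (l+N-1)/N)`. -/
def deltaArray (N : ℕ) (l : ℂ) : Fin N → ℂ := fun i => (l + ((i : ℕ) : ℂ)) / (N : ℂ)

/-- The array `Δ*(N; j+1)` with `N = M + 1` and `0 ≤ j ≤ N - 1`: the array
`((j+1)/N, …, (j+N)/N)` with its entry `N/N`, the one of index `N-1-j`, omitted. -/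
def deltaStar (M : ℕ) (j : Fin (M + 1)) : Fin M → ℂ :=
  j.rev.removeNth (deltaArray (M + 1) (1 + ((j : ℕ) : ℂ)))

/-- The argument `-1/(64 y²) {λb ((λb+c)/c)_k / (λb/c)_k}⁴` of the functions `₂F₃`. -/
def cosArg (b c lam y : ℝ) (k : ℕ) : ℂ :=
  -1 / (64 * (y : ℂ) ^ 2) *
    ((lam : ℂ) * (b : ℂ) * poch (((lam : ℂ) * (b : ℂ) + (c : ℂ)) / (c : ℂ)) k /
      poch ((lam : ℂ) * (b : ℂ) / (c : ℂ)) k) ^ 4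

/-- The inner sum over `j = 0, 1, 2, 3` of the four `₂F₃` terms. -/
def cosInner (υ : ℂ) (b c lam y : ℝ) (k : ℕ) : ℂ :=
  ∑ j : Fin 4,
    (-1) ^ (j : ℕ) * ((lam : ℂ) * (b : ℂ) + (c : ℂ) * (k : ℂ)) ^ (j : ℕ) *
        Complex.Gamma (υ + ((j : ℕ) : ℂ) / 2) /
      ((y : ℂ) ^ (((j : ℕ) : ℂ) / 2) * (((j : ℕ).factorial : ℕ) : ℂ)) *
      Complex.cos (υ * (Real.pi : ℂ) / 2 + ((j : ℕ) : ℂ) * (Real.pi : ℂ) / 4) *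
      pFq (deltaArray 2 ((2 * υ + ((j : ℕ) : ℂ)) / 2)) (deltaStar 3 j) (cosArg b c lam y k)

/-- The integrand of `J_C(υ, b, c, λ, y)`. -/
def integrandJ {r s : ℕ} (α : Fin r → ℂ) (A : Fin r → ℝ) (β : Fin s → ℂ) (B : Fin s → ℝ)
    (υ : ℂ) (b c lam y x : ℝ) : ℂ :=
  (x : ℂ) ^ (υ - 1) * (Real.exp (-b * lam * √x) : ℂ) *
    foxWright α A β B (Real.exp (-c * √x) : ℂ) * (Real.cos (x * y) : ℂ)

/-- `J_C(υ, b, c, λ, y)`. -/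
def integralJ {r s : ℕ} (α : Fin r → ℂ) (A : Fin r → ℝ) (β : Fin s → ℂ) (B : Fin s → ℝ)
    (υ : ℂ) (b c lam y : ℝ) : ℂ :=
  ∫ x in Set.Ioi (0 : ℝ), integrandJ α A β B υ b c lam y x

/-- The integrand of `K_C(υ, b, c, λ, y)`. -/
def integrandK {r s : ℕ} (α : Fin r → ℂ) (β : Fin s → ℂ) (υ : ℂ) (b c lam y x : ℝ) : ℂ :=
  (x : ℂ) ^ (υ - 1) * (Real.exp (-b * lam * √x) : ℂ) *
    pFq α β (Real.exp (-c * √x) : ℂ) * (Real.cos (x * y) : ℂ)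

/-- `K_C(υ, b, c, λ, y)`. -/
def integralK {r s : ℕ} (α : Fin r → ℂ) (β : Fin s → ℂ) (υ : ℂ) (b c lam y : ℝ) : ℂ :=
  ∫ x in Set.Ioi (0 : ℝ), integrandK α β υ b c lam y x

/-- The `k`-th term of the expansion of `y^υ J_C`. -/
def seriesTermJ {r s : ℕ} (α : Fin r → ℂ) (A : Fin r → ℝ) (β : Fin s → ℂ) (B : Fin s → ℝ)
    (υ : ℂ) (b c lam y : ℝ) (k : ℕ) : ℂ :=
  foxWrightCoeff α A β B k / (k.factorial : ℂ) * cosInner υ b c lam y k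

/-- The `k`-th term of the expansion of `y^υ K_C`. -/
def seriesTermK {r s : ℕ} (α : Fin r → ℂ) (β : Fin s → ℂ) (υ : ℂ) (b c lam y : ℝ) (k : ℕ) : ℂ :=
  (∏ i, poch (α i) k) / ((∏ j, poch (β j) k) * (k.factorial : ℂ)) * cosInner υ b c lam y k

end

open MeasureTheory Filter Topology Set Asymptotics

/-! Both special functions are power series `∑ θ_k z^k` at `z = e^(-c√x)`, so the integral splits
into integrals of `x^(υ-1) e^(-a√x) cos(xy)` with `a = λb + ck`, and two things remain: evaluating
one such integral, and justifying the interchange.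

Evaluation. For `Re p > 0`, expanding `e^(-a√x)` in powers of `a` turns the Laplace integral into a
series of Gamma integrals (`integral_cpow_mul_exp_sqrt_mul_cexp`). On `Re p = 0` those integrals no
longer converge absolutely, so the formula is carried there by a limit, dominated on both sides
(`integral_cpow_mul_exp_sqrt_mul_cexp_imag`). Averaging over `p = ±iy` gives the cosine integral. In
the resulting series, `n ↦ n + 4` shifts the cosine's argument by `π`; hence each residue class mod
4 is one `₂F₃` (`cosTerm_add_four_mul`, `tsum_cosTerm`).

Interchange. The `k`-th integral of absolute values is at most a constant times `|θ_k| (k+1)^(-2 Re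
υ)`, so summability of these numbers suffices (`integral_tsum_mul_exp_sqrt`). For Fox–Wright
coefficients it follows from Stirling bounds, with the reflection formula for negative `Aᵢ`, `Bⱼ`
(`foxWrightSummable_of_conditions`). The `ᵣFₛ` case either terminates or reduces to `Aᵢ = Bⱼ = 1`.
-/

/-! ### The Gamma integral with a complex rate. -/

lemma measurable_cpow_mul_cexp (a p : ℂ) :
    Measurable fun t : ℝ => (t : ℂ) ^ a * Complex.exp (-(p * t)) := by
  fun_prop

lemma norm_cpow_mul_cexp (a p : ℂ) {t : ℝ} (ht : 0 < t) :
    ‖(t : ℂ) ^ a * Complex.exp (-(p * t))‖ = t ^ a.re * Real.exp (-p.re * t) := by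
  rw [norm_mul, Complex.norm_cpow_eq_rpow_re_of_pos ht, Complex.norm_exp]
  simp

lemma integrableOn_rpow_mul_exp_neg_mul {s r : ℝ} (hs : -1 < s) (hr : 0 < r) :
    IntegrableOn (fun t : ℝ => t ^ s * Real.exp (-r * t)) (Ioi 0) := by
  simpa using integrableOn_rpow_mul_exp_neg_mul_rpow hs one_pos hr

lemma integrableOn_cpow_mul_cexp {a p : ℂ} (ha : 0 < a.re) (hp : 0 < p.re) :
    IntegrableOn (fun t : ℝ => (t : ℂ) ^ (a - 1) * Complex.exp (-(p * t))) (Ioi 0) := by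
  refine (integrableOn_rpow_mul_exp_neg_mul (s := (a - 1).re) (by simpa using ha) hp).mono'
    (measurable_cpow_mul_cexp _ _).aestronglyMeasurable ?_
  filter_upwards [ae_restrict_mem measurableSet_Ioi] with t ht
  exact (norm_cpow_mul_cexp _ _ ht).le

lemma differentiableAt_integral_cpow_mul_cexp {a p : ℂ} (ha : 0 < a.re) (hp : 0 < p.re) :
    DifferentiableAt ℂ
      (fun p : ℂ => ∫ t in Ioi (0 : ℝ), (t : ℂ) ^ (a - 1) * Complex.exp (-(p * t))) p := by
  -- On this half-plane the exponential has the uniform decay rate `p.re / 2`, which yields an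
  -- integrable bound for the derivative.
  have hs : {q : ℂ | p.re / 2 < q.re} ∈ 𝓝 p :=
    (isOpen_lt continuous_const Complex.continuous_re).mem_nhds (by simpa using hp)
  refine (hasDerivAt_integral_of_dominated_loc_of_deriv_le
    (F := fun (q : ℂ) (t : ℝ) => (t : ℂ) ^ (a - 1) * Complex.exp (-(q * t)))
    (F' := fun q t => (t : ℂ) ^ (a - 1) * (Complex.exp (-(q * t)) * -(t : ℂ)))
    (bound := fun t => t ^ a.re * Real.exp (-(p.re / 2) * t)) hs
    (Eventually.of_forall fun q => (measurable_cpow_mul_cexp _ _).aestronglyMeasurable)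
    (integrableOn_cpow_mul_cexp ha hp) ?_ ?_ ?_ ?_).2.differentiableAt
  · exact Measurable.aestronglyMeasurable (by fun_prop)
  · filter_upwards [ae_restrict_mem measurableSet_Ioi] with t ht q hq
    have ht' : 0 < t := ht
    rw [← mul_assoc, norm_mul, norm_cpow_mul_cexp _ _ ht, norm_neg, Complex.norm_real,
      Real.norm_of_nonneg ht'.le, mul_right_comm, ← Real.rpow_add_one ht'.ne']
    have : (a - 1).re + 1 = a.re := by simp
    rw [this]
    have hq' : p.re / 2 < q.re := hq
    gcongr
  · exact integrableOn_rpow_mul_exp_neg_mul (by linarith) (by linarith)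
  · refine ae_of_all _ fun t q _ => HasDerivAt.const_mul _ (HasDerivAt.cexp ?_)
    exact (hasDerivAt_mul_const (t : ℂ)).fun_neg

/-- Identity theorem: both sides are holomorphic in `p` on the right half-plane and agree at the
positive reals, which accumulate at `1`. -/
theorem integral_cpow_mul_cexp {a p : ℂ} (ha : 0 < a.re) (hp : 0 < p.re) :
    ∫ t in Ioi (0 : ℝ), (t : ℂ) ^ (a - 1) * Complex.exp (-(p * t)) =
      p ^ (-a) * Complex.Gamma a := by
  have hopen : IsOpen {q : ℂ | 0 < q.re} := isOpen_lt continuous_const Complex.continuous_re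
  have hU : IsPreconnected {q : ℂ | 0 < q.re} := (convex_halfSpace_re_gt 0).isPreconnected
  refine AnalyticOnNhd.eqOn_of_preconnected_of_frequently_eq (𝕜 := ℂ) (z₀ := 1)
    (f := fun p : ℂ => ∫ t in Ioi (0 : ℝ), (t : ℂ) ^ (a - 1) * Complex.exp (-(p * t)))
    (g := fun p : ℂ => p ^ (-a) * Complex.Gamma a)
    (DifferentiableOn.analyticOnNhd
      (fun q hq => (differentiableAt_integral_cpow_mul_cexp ha hq).differentiableWithinAt) hopen)
    (DifferentiableOn.analyticOnNhd (fun q hq => ?_) hopen) hU (show (0 : ℝ) < (1 : ℂ).re by simp) ?_ hp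
  · refine DifferentiableAt.differentiableWithinAt (DifferentiableAt.mul_const ?_ _)
    exact differentiableAt_id.cpow_const (Or.inl hq)
  · have hreal : ∀ r : ℝ, 0 < r → (∫ t in Ioi (0 : ℝ), (t : ℂ) ^ (a - 1) *
        Complex.exp (-((r : ℂ) * t))) = (r : ℂ) ^ (-a) * Complex.Gamma a := fun r hr => by
      rw [Complex.integral_cpow_mul_exp_neg_mul_Ioi ha hr, one_div, Complex.inv_cpow,
        Complex.cpow_neg]
      rw [Complex.arg_ofReal_of_nonneg hr.le]
      exact Real.pi_pos.ne
    have htend : Tendsto (fun r : ℝ => (r : ℂ)) (𝓝[≠] 1) (𝓝[≠] (1 : ℂ)) := by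
      refine tendsto_nhdsWithin_iff.2 ⟨?_, ?_⟩
      · exact (Complex.continuous_ofReal.tendsto' 1 1 (by simp)).mono_left nhdsWithin_le_nhds
      · filter_upwards [self_mem_nhdsWithin] with r hr
        simpa using hr
    refine htend.frequently (Eventually.frequently ?_)
    filter_upwards [nhdsWithin_le_nhds (lt_mem_nhds one_pos)] with r hr using hreal r hr

/-! ### Expansion of the Laplace integral in powers of `a`. -/

/-- Log-convexity of `Γ` at a half step. -/
lemma Gamma_add_half_le {s : ℝ} (hs : 0 < s) : Real.Gamma (s + 1 / 2) ≤ √s * Real.Gamma s := by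
  have h := Real.Gamma_mul_add_mul_le_rpow_Gamma_mul_rpow_Gamma hs (by linarith : 0 < s + 1)
    (by norm_num : (0 : ℝ) < 1 / 2) (by norm_num : (0 : ℝ) < 1 / 2) (by norm_num)
  have hG := Real.Gamma_pos_of_pos hs
  rw [Real.Gamma_add_one hs.ne', ← Real.sqrt_eq_rpow, ← Real.sqrt_eq_rpow,
    Real.sqrt_mul hs.le, mul_comm (√s), ← mul_assoc, Real.mul_self_sqrt hG.le] at h
  rw [mul_comm]
  convert h using 2
  ring

/-- Ratio test: a half step of `Γ` costs only a square root, so consecutive terms have ratio at most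
`w √(σ+n) / (n+1)`, which tends to `0`. -/
lemma summable_Gamma_half_mul_pow_div_factorial {σ : ℝ} (hσ : 0 < σ) {w : ℝ} (hw : 0 ≤ w) :
    Summable fun n : ℕ => Real.Gamma (σ + n / 2) * w ^ n / n.factorial := by
  have hlim : Tendsto (fun n : ℕ => w * (√(σ + n) / (n + 1))) atTop (𝓝 (w * 0)) := by
    refine Tendsto.const_mul _ ?_
    have h1 : Tendsto (fun n : ℕ => √(σ + 1) / √((n : ℝ) + 1)) atTop (𝓝 0) :=
      tendsto_const_nhds.div_atTop (Real.tendsto_sqrt_atTop.comp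
        (tendsto_atTop_add_const_right _ _ tendsto_natCast_atTop_atTop))
    refine squeeze_zero (fun n => by positivity) (fun n => ?_) h1
    have hn : (0 : ℝ) ≤ n := Nat.cast_nonneg n
    rw [div_le_div_iff₀ (by positivity) (by positivity)]
    rw [← Real.sqrt_mul (by positivity)]
    calc √((σ + n) * (n + 1)) ≤ √((σ + 1) * ((n + 1) * (n + 1))) := by
          apply Real.sqrt_le_sqrt
          nlinarith [mul_nonneg hσ.le hn, mul_nonneg (mul_nonneg hσ.le hn) hn]
      _ = √(σ + 1) * (n + 1) := by
          rw [Real.sqrt_mul (by positivity), Real.sqrt_mul_self (by positivity)]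
  rw [mul_zero] at hlim
  refine summable_of_ratio_norm_eventually_le (r := 1 / 2) (by norm_num) ?_
  filter_upwards [hlim.eventually (gt_mem_nhds (by norm_num : (0 : ℝ) < 1 / 2))] with n hn
  have hσn : 0 < σ + n / 2 := by positivity
  have hG := Real.Gamma_pos_of_pos hσn
  have hG' := Real.Gamma_pos_of_pos (show 0 < σ + ((n + 1 : ℕ) : ℝ) / 2 by positivity)
  rw [Real.norm_of_nonneg (by positivity), Real.norm_of_nonneg (by positivity)]
  have hstep : Real.Gamma (σ + ((n + 1 : ℕ) : ℝ) / 2) ≤ √(σ + n) * Real.Gamma (σ + n / 2) := by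
    have := Gamma_add_half_le hσn
    have h2 : √(σ + n / 2) ≤ √(σ + n) := Real.sqrt_le_sqrt (by
      have : (0 : ℝ) ≤ n := Nat.cast_nonneg n
      linarith)
    calc _ = Real.Gamma (σ + n / 2 + 1 / 2) := by push_cast; ring_nf
      _ ≤ _ := this.trans (by gcongr)
  calc Real.Gamma (σ + ((n + 1 : ℕ) : ℝ) / 2) * w ^ (n + 1) / (n + 1).factorial
      ≤ √(σ + n) * Real.Gamma (σ + n / 2) * w ^ (n + 1) / (n + 1).factorial := by gcongr
    _ = (w * (√(σ + n) / (n + 1))) * (Real.Gamma (σ + n / 2) * w ^ n / n.factorial) := by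
        rw [Nat.factorial_succ]; push_cast; rw [pow_succ]; field_simp
    _ ≤ _ := by gcongr

/-- The `n`-th term of the expansion of `∫ x^(υ-1) e^(-a√x) e^(-px) dx` in powers of `a`. -/
noncomputable def laplaceTerm (υ : ℂ) (a : ℝ) (p : ℂ) (n : ℕ) : ℂ :=
  (-(a : ℂ)) ^ n / (n.factorial : ℂ) * (p ^ (-(υ + n / 2)) * Complex.Gamma (υ + n / 2))

theorem integral_cpow_mul_exp_sqrt_mul_cexp {υ : ℂ} (hυ : 0 < υ.re) {a : ℝ} {p : ℂ}
    (hp : 0 < p.re) :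
    ∫ x in Ioi (0 : ℝ), (x : ℂ) ^ (υ - 1) * (Real.exp (-a * √x) : ℂ) * Complex.exp (-(p * x)) =
      ∑' n, laplaceTerm υ a p n := by
  have hre : ∀ n : ℕ, 0 < (υ + n / 2).re := fun n => by
    have : ((n : ℂ) / 2).re = (n : ℝ) / 2 := by simp
    rw [Complex.add_re, this]; positivity
  have hint : ∀ n : ℕ, IntegrableOn (fun x : ℝ => (-(a : ℂ)) ^ n / (n.factorial : ℂ) *
      ((x : ℂ) ^ (υ + n / 2 - 1) * Complex.exp (-(p * x)))) (Ioi 0) := fun n =>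
    (integrableOn_cpow_mul_cexp (hre n) hp).const_mul _
  have hnorm : ∀ n : ℕ, ∫ x in Ioi (0 : ℝ), ‖(-(a : ℂ)) ^ n / (n.factorial : ℂ) *
      ((x : ℂ) ^ (υ + n / 2 - 1) * Complex.exp (-(p * x)))‖ = p.re ^ (-υ.re) *
      (Real.Gamma (υ.re + n / 2) * (|a| / √p.re) ^ n / n.factorial) := fun n => by
    have h1 : ∀ x ∈ Ioi (0 : ℝ), ‖(-(a : ℂ)) ^ n / (n.factorial : ℂ) *
      ((x : ℂ) ^ (υ + n / 2 - 1) * Complex.exp (-(p * x)))‖ = |a| ^ n / n.factorial *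
        (x ^ (υ.re + n / 2 - 1) * Real.exp (-(p.re * x))) := fun x hx => by
      rw [norm_mul, norm_cpow_mul_cexp _ _ hx]
      simp
    rw [setIntegral_congr_fun measurableSet_Ioi h1, integral_const_mul,
      Real.integral_rpow_mul_exp_neg_mul_Ioi (by positivity) hp, one_div, Real.inv_rpow hp.le,
      Real.rpow_add hp, Real.rpow_neg hp.le, div_pow, Real.sqrt_eq_rpow, ← Real.rpow_natCast,
      ← Real.rpow_natCast (p.re ^ _), ← Real.rpow_mul hp.le]
    rw [show (1 / 2 : ℝ) * n = n / 2 by ring]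
    field_simp
  have hsum := hasSum_integral_of_summable_integral_norm hint (by
    simp_rw [hnorm]
    exact (summable_Gamma_half_mul_pow_div_factorial hυ (by positivity)).mul_left _)
  have hterm : ∀ n : ℕ, ∫ x in Ioi (0 : ℝ), (-(a : ℂ)) ^ n / (n.factorial : ℂ) *
      ((x : ℂ) ^ (υ + n / 2 - 1) * Complex.exp (-(p * x))) = laplaceTerm υ a p n := fun n => by
    rw [integral_const_mul, integral_cpow_mul_cexp (hre n) hp, laplaceTerm]
  simp_rw [hterm] at hsum
  rw [hsum.tsum_eq]
  refine setIntegral_congr_fun measurableSet_Ioi fun x hx => ?_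
  have hx' : 0 < x := hx
  have hxc : (x : ℂ) ≠ 0 := by exact_mod_cast hx'.ne'
  have h2 : ∀ n : ℕ, (-(a : ℂ)) ^ n / (n.factorial : ℂ) *
      ((x : ℂ) ^ (υ + n / 2 - 1) * Complex.exp (-(p * x))) =
      (x : ℂ) ^ (υ - 1) * Complex.exp (-(p * x)) *
        (((-a * √x : ℝ) : ℂ) ^ n / (n.factorial : ℂ)) := fun n => by
    have h3 : (x : ℂ) ^ (υ + n / 2 - 1) = (x : ℂ) ^ (υ - 1) * ((√x : ℝ) : ℂ) ^ n := by
      rw [show υ + (n : ℂ) / 2 - 1 = (υ - 1) + (n : ℂ) / 2 by ring, Complex.cpow_add _ _ hxc]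
      congr 1
      rw [Real.sqrt_eq_rpow, Complex.ofReal_cpow hx'.le, ← Complex.cpow_mul_nat]
      push_cast
      ring_nf
    rw [h3]; push_cast; rw [mul_pow]; ring
  simp_rw [h2]
  rw [tsum_mul_left, Complex.ofReal_exp, Complex.exp_eq_exp_ℂ, NormedSpace.exp_eq_tsum_div]
  ring

/-! ### Passage to the imaginary axis. -/

lemma norm_cpow_le_mul_exp {p : ℂ} (s : ℂ) :
    ‖p ^ s‖ ≤ ‖p‖ ^ s.re * Real.exp (Real.pi * |s.im|) := by
  refine (Complex.norm_cpow_le p s).trans ?_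
  rw [div_eq_mul_inv, ← Real.exp_neg]
  gcongr
  calc -(p.arg * s.im) ≤ |p.arg * s.im| := neg_le_abs _
    _ = |p.arg| * |s.im| := abs_mul _ _
    _ ≤ _ := by gcongr; exact Complex.abs_arg_le_pi p

lemma norm_Gamma_le {s : ℂ} (hs : 0 < s.re) : ‖Complex.Gamma s‖ ≤ Real.Gamma s.re := by
  rw [Complex.Gamma_eq_integral hs, Real.Gamma_eq_integral hs, Complex.GammaIntegral]
  refine (norm_integral_le_integral_norm _).trans_eq ?_
  refine setIntegral_congr_fun measurableSet_Ioi fun x hx => ?_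
  have hx' : 0 < x := hx
  rw [norm_mul, Complex.norm_real, Complex.norm_cpow_eq_rpow_re_of_pos hx',
    Real.norm_of_nonneg (Real.exp_pos _).le]
  simp

/-- A majorant of `laplaceTerm υ a p` for all `p` with `y ≤ ‖p‖`. -/
noncomputable def laplaceBound (υ : ℂ) (a y : ℝ) (n : ℕ) : ℝ :=
  y ^ (-υ.re) * Real.exp (Real.pi * |υ.im|) *
    (Real.Gamma (υ.re + n / 2) * (|a| / √y) ^ n / n.factorial)

lemma summable_laplaceBound {υ : ℂ} (hυ : 0 < υ.re) (a y : ℝ) :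
    Summable (laplaceBound υ a y) :=
  (summable_Gamma_half_mul_pow_div_factorial hυ (by positivity)).mul_left _

/-- The exponent `υ + n/2` has imaginary part independent of `n`, so the argument of `p` contributes
only the fixed factor `e^(π|Im υ|)`. -/
lemma norm_laplaceTerm_le_bound {υ : ℂ} (hυ : 0 < υ.re) (a : ℝ) {y : ℝ} (hy : 0 < y) {p : ℂ}
    (hp : y ≤ ‖p‖) (n : ℕ) : ‖laplaceTerm υ a p n‖ ≤ laplaceBound υ a y n := by
  have hre : (υ + n / 2).re = υ.re + n / 2 := by simp
  have him : (υ + n / 2).im = υ.im := by simp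
  have hpos : 0 < υ.re + (n : ℝ) / 2 := by positivity
  have h1 : ‖p ^ (-(υ + n / 2))‖ ≤ y ^ (-υ.re) * (√y ^ n)⁻¹ * Real.exp (Real.pi * |υ.im|) := by
    refine (norm_cpow_le_mul_exp _).trans ?_
    rw [Complex.neg_re, Complex.neg_im, hre, him, abs_neg]
    refine mul_le_mul_of_nonneg_right ?_ (Real.exp_pos _).le
    refine (Real.rpow_le_rpow_of_nonpos hy hp (by linarith)).trans_eq ?_
    rw [neg_add, Real.rpow_add hy, Real.rpow_neg hy.le ((n : ℝ) / 2), Real.sqrt_eq_rpow,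
      ← Real.rpow_natCast, ← Real.rpow_mul hy.le]
    ring_nf
  have h2 : ‖Complex.Gamma (υ + n / 2)‖ ≤ Real.Gamma (υ.re + n / 2) :=
    hre ▸ norm_Gamma_le (by rw [hre]; exact hpos)
  rw [laplaceTerm, laplaceBound, norm_mul, norm_mul, norm_div, norm_pow, norm_neg,
    Complex.norm_real, Complex.norm_natCast, Real.norm_eq_abs]
  calc _ ≤ |a| ^ n / n.factorial * ((y ^ (-υ.re) * (√y ^ n)⁻¹ * Real.exp (Real.pi * |υ.im|)) *
        Real.Gamma (υ.re + n / 2)) := by gcongr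
    _ = _ := by rw [div_pow]; field_simp

lemma integrableOn_rpow_mul_exp_neg_mul_sqrt {s a : ℝ} (hs : -1 < s) (ha : 0 < a) :
    IntegrableOn (fun x : ℝ => x ^ s * Real.exp (-a * √x)) (Ioi 0) := by
  simpa only [Real.sqrt_eq_rpow] using
    integrableOn_rpow_mul_exp_neg_mul_rpow hs (by norm_num : (0 : ℝ) < 1 / 2) ha

lemma norm_cpow_mul_exp_neg_mul_sqrt (υ : ℂ) (a : ℝ) {x : ℝ} (hx : 0 < x) :
    ‖(x : ℂ) ^ (υ - 1) * (Real.exp (-a * √x) : ℂ)‖ = x ^ (υ.re - 1) * Real.exp (-a * √x) := by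
  rw [norm_mul, Complex.norm_cpow_eq_rpow_re_of_pos hx, Complex.norm_real,
    Real.norm_of_nonneg (Real.exp_pos _).le]
  simp

/-- Let `ε ↓ 0` in the formula at `p + ε`. The series is dominated because `|p + ε| ≥ |Im p|`, the
integral because `e^(-a√x)` decays; this is where `a > 0` enters. Powers are continuous at `p`,
which is off the branch cut. -/
theorem integral_cpow_mul_exp_sqrt_mul_cexp_imag {υ : ℂ} (hυ : 0 < υ.re) {a : ℝ} (ha : 0 < a)
    {p : ℂ} (hp : p.re = 0) (hp' : p.im ≠ 0) :
    ∫ x in Ioi (0 : ℝ), (x : ℂ) ^ (υ - 1) * (Real.exp (-a * √x) : ℂ) * Complex.exp (-(p * x)) =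
      ∑' n, laplaceTerm υ a p n := by
  have hy : 0 < |p.im| := abs_pos.2 hp'
  have hpslit : p ∈ Complex.slitPlane := Or.inr hp'
  have htend : Tendsto (fun ε : ℝ => p + ε) (𝓝[>] 0) (𝓝 p) := by
    have : Continuous fun ε : ℝ => p + ε := by fun_prop
    exact (this.tendsto' 0 p (by simp)).mono_left nhdsWithin_le_nhds
  have hR : Tendsto (fun ε : ℝ => ∑' n, laplaceTerm υ a (p + ε) n) (𝓝[>] 0)
      (𝓝 (∑' n, laplaceTerm υ a p n)) := by
    refine tendsto_tsum_of_dominated_convergence (summable_laplaceBound hυ a |p.im|) (fun n => ?_)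
      (Eventually.of_forall fun ε n => norm_laplaceTerm_le_bound hυ a hy ?_ n)
    · unfold laplaceTerm
      refine Tendsto.const_mul _ (Tendsto.mul_const _ ?_)
      exact (continuousAt_cpow_const hpslit).tendsto.comp htend
    · simpa using Complex.abs_im_le_norm (p + ε)
  have hL : Tendsto (fun ε : ℝ => ∫ x in Ioi (0 : ℝ), (x : ℂ) ^ (υ - 1) *
      (Real.exp (-a * √x) : ℂ) * Complex.exp (-((p + ε) * x))) (𝓝[>] 0)
      (𝓝 (∫ x in Ioi (0 : ℝ), (x : ℂ) ^ (υ - 1) *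
      (Real.exp (-a * √x) : ℂ) * Complex.exp (-(p * x)))) := by
    refine tendsto_integral_filter_of_dominated_convergence
      (fun x => x ^ (υ.re - 1) * Real.exp (-a * √x))
      (Eventually.of_forall fun ε => Measurable.aestronglyMeasurable (by fun_prop)) ?_
      (integrableOn_rpow_mul_exp_neg_mul_sqrt (by linarith) ha) ?_
    · filter_upwards [self_mem_nhdsWithin] with ε hε
      filter_upwards [ae_restrict_mem measurableSet_Ioi] with x hx
      have hx' : 0 < x := hx
      have hε' : 0 < ε := hε
      rw [norm_mul, norm_cpow_mul_exp_neg_mul_sqrt _ _ hx]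
      refine mul_le_of_le_one_right (by positivity) ?_
      rw [Complex.norm_exp, Real.exp_le_one_iff]
      simp [hp]
      positivity
    · refine ae_of_all _ fun x => Tendsto.const_mul _ ?_
      have : Continuous fun q : ℂ => Complex.exp (-(q * x)) := by fun_prop
      exact (this.tendsto p).comp htend
  refine tendsto_nhds_unique hL (hR.congr' ?_)
  filter_upwards [self_mem_nhdsWithin] with ε hε
  refine (integral_cpow_mul_exp_sqrt_mul_cexp hυ ?_).symm
  simpa [hp] using hε

/-! ### The cosine integral as a series. -/

/-- The `n`-th term of the expansion of `y^υ ∫ x^(υ-1) e^(-a√x) cos(xy) dx` in powers of `a`. -/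
noncomputable def cosTerm (υ : ℂ) (a y : ℝ) (n : ℕ) : ℂ :=
  (-(a : ℂ)) ^ n / (n.factorial : ℂ) * (Complex.Gamma (υ + n / 2) *
    ((y : ℂ) ^ (-((n : ℂ) / 2)) * Complex.cos ((υ + n / 2) * Real.pi / 2)))

/-- Since `log(±iy) = log y ± iπ/2`, the powers `(±iy)^(-s)` are `y^(-s) e^(∓iπs/2)`. -/
lemma laplaceTerm_add_eq_cosTerm {υ : ℂ} {a y : ℝ} (hy : 0 < y) (n : ℕ) :
    laplaceTerm υ a (Complex.I * y) n + laplaceTerm υ a (-(Complex.I * y)) n =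
      2 * ((y : ℂ) ^ (-υ) * cosTerm υ a y n) := by
  have hyc : (y : ℂ) ≠ 0 := by exact_mod_cast hy.ne'
  have h1 : ∀ s : ℂ, (Complex.I * y) ^ (-s) + (-(Complex.I * y)) ^ (-s) =
      2 * ((y : ℂ) ^ (-s) * Complex.cos (s * Real.pi / 2)) := fun s => by
    have e1 : (Complex.I * y) ^ (-s) = Complex.exp (-(s * Real.pi / 2) * Complex.I) *
        (y : ℂ) ^ (-s) := by
      rw [mul_comm Complex.I, Complex.cpow_def_of_ne_zero (by simp [hyc]),
        Complex.cpow_def_of_ne_zero hyc, Complex.log_ofReal_mul hy Complex.I_ne_zero,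
        Complex.log_I, Complex.ofReal_log hy.le, ← Complex.exp_add]
      ring_nf
    have e2 : (-(Complex.I * y)) ^ (-s) = Complex.exp ((s * Real.pi / 2) * Complex.I) *
        (y : ℂ) ^ (-s) := by
      rw [mul_comm Complex.I, ← mul_neg, Complex.cpow_def_of_ne_zero (by simp [hyc]),
        Complex.cpow_def_of_ne_zero hyc, Complex.log_ofReal_mul hy (by simp),
        Complex.log_neg_I, Complex.ofReal_log hy.le, ← Complex.exp_add]
      ring_nf
    rw [e1, e2, Complex.cos]
    ring
  rw [laplaceTerm, laplaceTerm, cosTerm, ← mul_add, ← add_mul, h1, neg_add,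
    Complex.cpow_add _ _ hyc]
  ring

lemma summable_cosTerm {υ : ℂ} (hυ : 0 < υ.re) (a : ℝ) {y : ℝ} (hy : 0 < y) :
    Summable (cosTerm υ a y) := by
  have hb : ∀ p : ℂ, ‖p‖ = y → Summable (laplaceTerm υ a p) := fun p hp =>
    (summable_laplaceBound hυ a y).of_norm_bounded (norm_laplaceTerm_le_bound hυ a hy hp.ge)
  have h := (hb (Complex.I * y) (by simp [abs_of_pos hy])).add
    (hb (-(Complex.I * y)) (by simp [abs_of_pos hy]))
  simp_rw [laplaceTerm_add_eq_cosTerm hy] at h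
  have hyc : (y : ℂ) ^ (-υ) ≠ 0 := by
    rw [Complex.cpow_ne_zero_iff]; left; exact_mod_cast hy.ne'
  exact (summable_mul_left_iff hyc).1 ((summable_mul_left_iff two_ne_zero).1 h)

theorem integral_cpow_mul_exp_sqrt_mul_cos {υ : ℂ} (hυ : 0 < υ.re) {a y : ℝ} (ha : 0 < a)
    (hy : 0 < y) :
    ∫ x in Ioi (0 : ℝ), (x : ℂ) ^ (υ - 1) * (Real.exp (-a * √x) : ℂ) * (Real.cos (x * y) : ℂ) =
      (y : ℂ) ^ (-υ) * ∑' n, cosTerm υ a y n := by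
  have hb : ∀ p : ℂ, ‖p‖ = y → Summable (laplaceTerm υ a p) := fun p hp =>
    (summable_laplaceBound hυ a y).of_norm_bounded (norm_laplaceTerm_le_bound hυ a hy hp.ge)
  have hint : ∀ p : ℂ, p.re = 0 → IntegrableOn (fun x : ℝ => (x : ℂ) ^ (υ - 1) *
      (Real.exp (-a * √x) : ℂ) * Complex.exp (-(p * x))) (Ioi 0) := fun p hp => by
    refine (integrableOn_rpow_mul_exp_neg_mul_sqrt (s := υ.re - 1) (by linarith) ha).mono'
      (Measurable.aestronglyMeasurable (by fun_prop)) ?_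
    filter_upwards [ae_restrict_mem measurableSet_Ioi] with x hx
    rw [norm_mul, norm_cpow_mul_exp_neg_mul_sqrt _ _ hx, Complex.norm_exp]
    simp [hp]
  have h2 : (2 : ℂ) * ∫ x in Ioi (0 : ℝ), (x : ℂ) ^ (υ - 1) * (Real.exp (-a * √x) : ℂ) *
      (Real.cos (x * y) : ℂ) = 2 * ((y : ℂ) ^ (-υ) * ∑' n, cosTerm υ a y n) := by
    rw [← tsum_mul_left, ← tsum_mul_left]
    simp_rw [← laplaceTerm_add_eq_cosTerm hy]
    rw [Summable.tsum_add (hb _ (by simp [abs_of_pos hy])) (hb _ (by simp [abs_of_pos hy])),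
      ← integral_cpow_mul_exp_sqrt_mul_cexp_imag hυ ha (by simp) (by simp [hy.ne']),
      ← integral_cpow_mul_exp_sqrt_mul_cexp_imag hυ ha (by simp) (by simp [hy.ne']),
      ← integral_add (hint _ (by simp)) (hint _ (by simp)), ← integral_const_mul]
    refine setIntegral_congr_fun measurableSet_Ioi fun x _ => ?_
    simp only [Complex.ofReal_cos, Complex.cos]
    push_cast
    ring_nf
  exact mul_left_cancel₀ two_ne_zero h2

/-! ### Regrouping mod 4 into hypergeometric functions. -/

lemma poch_zero (a : ℂ) : poch a 0 = 1 := by simp [poch]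

lemma poch_succ (a : ℂ) (n : ℕ) : poch a (n + 1) = poch a n * (a + n) :=
  ascPochhammer_succ_eval n a

lemma poch_ne_zero {a : ℂ} (ha : ∀ n : ℕ, a ≠ -(n : ℂ)) (n : ℕ) : poch a n ≠ 0 := by
  induction n with
  | zero => simp [poch_zero]
  | succ n ih =>
    rw [poch_succ]
    exact mul_ne_zero ih fun h => ha n (eq_neg_of_add_eq_zero_left h)

lemma poch_one (n : ℕ) : poch 1 n = (n.factorial : ℂ) := by
  simp [poch, ascPochhammer_eval_one]

lemma poch_add_one_mul (a : ℂ) (n : ℕ) : poch (a + 1) n * a = poch a n * (a + n) := by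
  induction n with
  | zero => simp [poch_zero]
  | succ n ih =>
    rw [poch_succ, poch_succ, mul_right_comm, ih]
    push_cast
    ring

lemma ne_neg_natCast_of_re_pos {a : ℂ} (ha : 0 < a.re) (n : ℕ) : a ≠ -(n : ℂ) := fun h => by
  rw [h] at ha
  have : (0 : ℝ) ≤ n := Nat.cast_nonneg n
  simp at ha
  linarith

lemma Gamma_add_natCast {a : ℂ} (ha : ∀ n : ℕ, a ≠ -(n : ℂ)) (n : ℕ) :
    Complex.Gamma (a + n) = poch a n * Complex.Gamma a := by
  induction n with
  | zero => simp [poch_zero]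
  | succ n ih =>
    rw [Nat.cast_succ, ← add_assoc, Complex.Gamma_add_one, ih, poch_succ]
    · ring
    · exact fun h => ha n (eq_neg_of_add_eq_zero_left h)

/-- The duplication formula `(s)_{2m} = 4^m (s/2)_m ((s+1)/2)_m`. -/
lemma poch_two_mul (s : ℂ) (m : ℕ) :
    poch s (2 * m) = 4 ^ m * ∏ i, poch (deltaArray 2 s i) m := by
  induction m with
  | zero => simp [poch_zero]
  | succ m ih =>
    simp only [Fin.prod_univ_two] at ih ⊢
    rw [show 2 * (m + 1) = 2 * m + 1 + 1 by ring, poch_succ, poch_succ, ih, poch_succ, poch_succ]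
    simp only [deltaArray, Fin.val_zero, Fin.val_one]
    push_cast
    ring

lemma factorial_add_four_mul (j m : ℕ) :
    ((j + 4 * m).factorial : ℂ) =
      j.factorial * 256 ^ m * ∏ i, poch (deltaArray 4 (1 + (j : ℂ)) i) m := by
  induction m with
  | zero => simp [poch_zero]
  | succ m ih =>
    rw [show j + 4 * (m + 1) = (j + 4 * m) + 1 + 1 + 1 + 1 by ring, Nat.factorial_succ,
      Nat.factorial_succ, Nat.factorial_succ, Nat.factorial_succ]
    simp only [Nat.cast_mul]
    rw [ih]
    simp only [Fin.prod_univ_four, poch_succ, deltaArray]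
    push_cast
    simp
    ring

/-- The omitted entry, of index `3 - j`, equals `1`; its shifted factorial `m!` is the one built
into the definition of `₂F₃`. -/
lemma prod_poch_deltaStar (j : Fin 4) (m : ℕ) :
    ∏ i, poch (deltaArray 4 (1 + ((j : ℕ) : ℂ)) i) m =
      m.factorial * ∏ i, poch (deltaStar 3 j i) m := by
  rw [Fin.prod_univ_succAbove _ j.rev]
  have : deltaArray 4 (1 + ((j : ℕ) : ℂ)) j.rev = 1 := by
    fin_cases j <;> simp [deltaArray, Fin.rev] <;> norm_num
  rw [this, poch_one]
  rfl

lemma prod_poch_deltaStar_ne_zero (j : Fin 4) (m : ℕ) :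
    ∏ i, poch (deltaStar 3 j i) m ≠ 0 := by
  intro h
  have h1 := factorial_add_four_mul j m
  rw [prod_poch_deltaStar, h] at h1
  simp [Nat.factorial_ne_zero] at h1

/-- The constant `64` is `256 / 4`: `256^m` from splitting `(j+4m)!` into four shifted factorials,
`4^m` from duplicating `(s)_{2m}`. -/
lemma pFqTerm_deltaStar_mul (s z : ℂ) (hs : 0 < s.re) (j : Fin 4) (m : ℕ) :
    pFqTerm (deltaArray 2 s) (deltaStar 3 j) z m * Complex.Gamma s *
        ((j + 4 * m : ℕ).factorial : ℂ) =
      Complex.Gamma (s + 2 * m) * (j : ℕ).factorial * (64 * z) ^ m := by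
  have h1 := prod_poch_deltaStar_ne_zero j m
  have h2 : (m.factorial : ℂ) ≠ 0 := by exact_mod_cast m.factorial_ne_zero
  have h3 := Gamma_add_natCast (ne_neg_natCast_of_re_pos hs) (2 * m)
  push_cast at h3
  rw [factorial_add_four_mul, prod_poch_deltaStar, pFqTerm, h3, poch_two_mul]
  field_simp
  rw [show (256 : ℂ) = 4 * 64 by norm_num, mul_pow, mul_pow]
  ring

lemma re_add_half_pos {υ : ℂ} (hυ : 0 < υ.re) (n : ℕ) : 0 < (υ + n / 2).re := by
  have : ((n : ℂ) / 2).re = (n : ℝ) / 2 := by simp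
  rw [Complex.add_re, this]
  positivity

lemma summable_pFqTerm_deltaStar {υ : ℂ} (hυ : 0 < υ.re) (j : Fin 4) (z : ℂ) :
    Summable (pFqTerm (deltaArray 2 ((2 * υ + ((j : ℕ) : ℂ)) / 2)) (deltaStar 3 j) z) := by
  have hs := re_add_half_pos hυ j
  rw [show (2 * υ + ((j : ℕ) : ℂ)) / 2 = υ + (j : ℕ) / 2 by ring]
  set s : ℂ := υ + (j : ℕ) / 2 with hs_def
  have hG : Complex.Gamma s ≠ 0 := Complex.Gamma_ne_zero_of_re_pos hs
  -- Adding `1` makes this base `w ≥ 1`, so `64‖z‖ ≤ w ≤ w^4`; the terms are then dominated by the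
  -- entries `n = j + 4m` of the series in `w`.
  have hW : (0 : ℝ) < 64 * ‖z‖ + 1 := by positivity
  have hinj : Function.Injective fun m : ℕ => (j : ℕ) + 4 * m := fun m m' h => by
    simp only at h
    omega
  have hsum := ((summable_Gamma_half_mul_pow_div_factorial hυ hW.le).comp_injective hinj).mul_left
    (((j : ℕ).factorial : ℝ) / ((64 * ‖z‖ + 1) ^ (j : ℕ) * ‖Complex.Gamma s‖))
  refine hsum.of_norm_bounded fun m => ?_
  have h := congrArg norm (pFqTerm_deltaStar_mul s z hs j m)
  simp only [norm_mul, norm_pow, Complex.norm_natCast] at h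
  have hf : (0 : ℝ) < ((j : ℕ) + 4 * m).factorial := by positivity
  have hG' : 0 < ‖Complex.Gamma s‖ := norm_pos_iff.2 hG
  have hre : (s + 2 * m).re = υ.re + (((j : ℕ) + 4 * m : ℕ) : ℝ) / 2 := by
    simp [hs_def]; ring
  have hle : ‖Complex.Gamma (s + 2 * m)‖ ≤ Real.Gamma (υ.re + (((j : ℕ) + 4 * m : ℕ) : ℝ) / 2) := by
    rw [← hre]
    exact norm_Gamma_le (by rw [hre]; positivity)
  have hpow : (‖(64 : ℂ)‖ * ‖z‖) ^ m ≤ ((64 * ‖z‖ + 1) ^ 4) ^ m := by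
    refine pow_le_pow_left₀ (by positivity) ?_ m
    have : ‖(64 : ℂ)‖ = 64 := by simp
    rw [this]
    have := le_self_pow₀ (M₀ := ℝ) (a := 64 * ‖z‖ + 1) (by have := norm_nonneg z; linarith)
      (n := 4) (by norm_num)
    linarith
  calc ‖pFqTerm (deltaArray 2 s) (deltaStar 3 j) z m‖
      = ‖Complex.Gamma (s + 2 * m)‖ * ((j : ℕ).factorial : ℝ) * (‖(64 : ℂ)‖ * ‖z‖) ^ m /
          (‖Complex.Gamma s‖ * ((j : ℕ) + 4 * m).factorial) := by
        rw [eq_div_iff (by positivity), ← h]; ring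
    _ ≤ Real.Gamma (υ.re + (((j : ℕ) + 4 * m : ℕ) : ℝ) / 2) * ((j : ℕ).factorial : ℝ) *
          ((64 * ‖z‖ + 1) ^ 4) ^ m / (‖Complex.Gamma s‖ * ((j : ℕ) + 4 * m).factorial) := by
        gcongr
    _ = _ := by
        simp only [Function.comp]
        rw [pow_add, pow_mul]
        field_simp

/-- The coefficient of the `j`-th function `₂F₃`. -/
noncomputable def cosCoeff (υ : ℂ) (a y : ℝ) (j : ℕ) : ℂ :=
  (-1) ^ j * (a : ℂ) ^ j * Complex.Gamma (υ + j / 2) /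
    ((y : ℂ) ^ ((j : ℂ) / 2) * (j.factorial : ℂ)) *
    Complex.cos (υ * Real.pi / 2 + j * Real.pi / 4)

lemma cosTerm_add_four_mul {υ : ℂ} (hυ : 0 < υ.re) {a y : ℝ} (hy : 0 < y) (j : Fin 4) (m : ℕ) :
    cosTerm υ a y (j + 4 * m) = cosCoeff υ a y j *
      pFqTerm (deltaArray 2 ((2 * υ + ((j : ℕ) : ℂ)) / 2)) (deltaStar 3 j)
        (-1 / (64 * (y : ℂ) ^ 2) * (a : ℂ) ^ 4) m := by
  have hs := re_add_half_pos hυ j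
  rw [show (2 * υ + ((j : ℕ) : ℂ)) / 2 = υ + (j : ℕ) / 2 by ring]
  have hyc : (y : ℂ) ≠ 0 := by exact_mod_cast hy.ne'
  have hyj : (y : ℂ) ^ (((j : ℕ) : ℂ) / 2) ≠ 0 := by
    rw [Complex.cpow_ne_zero_iff]; exact Or.inl hyc
  have hG : Complex.Gamma (υ + (j : ℕ) / 2) ≠ 0 := Complex.Gamma_ne_zero_of_re_pos hs
  have hf : (((j : ℕ) + 4 * m : ℕ).factorial : ℂ) ≠ 0 := by exact_mod_cast Nat.factorial_ne_zero _
  have hj : ((j : ℕ).factorial : ℂ) ≠ 0 := by exact_mod_cast Nat.factorial_ne_zero _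
  have h := pFqTerm_deltaStar_mul _ (-1 / (64 * (y : ℂ) ^ 2) * (a : ℂ) ^ 4) hs j m
  rw [← eq_div_iff hf, ← eq_div_iff hG] at h
  rw [h, cosTerm, cosCoeff]
  have e1 : υ + (((j : ℕ) + 4 * m : ℕ) : ℂ) / 2 = υ + (j : ℕ) / 2 + 2 * m := by push_cast; ring
  have e2 : (y : ℂ) ^ (-((((j : ℕ) + 4 * m : ℕ) : ℂ) / 2)) =
      ((y : ℂ) ^ (((j : ℕ) : ℂ) / 2))⁻¹ * (((y : ℂ) ^ 2) ^ m)⁻¹ := by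
    rw [show (((j : ℕ) + 4 * m : ℕ) : ℂ) / 2 = (j : ℕ) / 2 + (2 * m : ℕ) by push_cast; ring,
      Complex.cpow_neg, Complex.cpow_add _ _ hyc, Complex.cpow_natCast, pow_mul, mul_inv]
  have e3 : Complex.cos ((υ + (j : ℕ) / 2 + 2 * m) * Real.pi / 2) =
      (-1) ^ m * Complex.cos (υ * Real.pi / 2 + (j : ℕ) * Real.pi / 4) := by
    rw [← Complex.cos_antiperiodic.add_nat_mul_eq m]
    ring_nf
  have e4 : (64 * (-1 / (64 * (y : ℂ) ^ 2) * (a : ℂ) ^ 4)) ^ m =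
      (-1) ^ m * ((a : ℂ) ^ 4) ^ m * (((y : ℂ) ^ 2) ^ m)⁻¹ := by
    rw [← inv_pow, ← mul_pow, ← mul_pow]
    congr 1
    field_simp
  have e5 : (-(a : ℂ)) ^ ((j : ℕ) + 4 * m) = (-1) ^ (j : ℕ) * (a : ℂ) ^ (j : ℕ) *
      ((a : ℂ) ^ 4) ^ m := by
    rw [pow_add, neg_pow, pow_mul]
    simp [Even.neg_pow (by decide : Even 4)]
  rw [e1, e2, e3, e4, e5]
  generalize Complex.Gamma (υ + (j : ℕ) / 2) = G at hG
  generalize Complex.Gamma (υ + (j : ℕ) / 2 + 2 * m) = G'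
  field_simp

lemma tsum_cosTerm {υ : ℂ} (hυ : 0 < υ.re) (a : ℝ) {y : ℝ} (hy : 0 < y) :
    ∑' n, cosTerm υ a y n = ∑ j : Fin 4, cosCoeff υ a y j *
      pFq (deltaArray 2 ((2 * υ + ((j : ℕ) : ℂ)) / 2)) (deltaStar 3 j)
        (-1 / (64 * (y : ℂ) ^ 2) * (a : ℂ) ^ 4) := by
  have e : ∀ q : Fin 4 × ℕ, ((Equiv.prodComm (Fin 4) ℕ).trans (Nat.divModEquiv 4).symm) q =
      (q.1 : ℕ) + 4 * q.2 := fun q => by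
    simp [Nat.divModEquiv]; ring
  have hs : Summable fun q : Fin 4 × ℕ => cosTerm υ a y ((q.1 : ℕ) + 4 * q.2) := by
    simp_rw [← e]
    exact (Equiv.summable_iff (f := cosTerm υ a y) _).2 (summable_cosTerm hυ a hy)
  rw [← Equiv.tsum_eq ((Equiv.prodComm (Fin 4) ℕ).trans (Nat.divModEquiv 4).symm)]
  simp_rw [e]
  rw [hs.tsum_prod, tsum_fintype]
  refine Finset.sum_congr rfl fun j _ => ?_
  simp_rw [cosTerm_add_four_mul hυ hy]
  rw [tsum_mul_left, pFq]

/-- With `z = λb/c`, telescoping gives `(z+1)_k / (z)_k = (z+k)/z`, so the braces contain just `λb +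
ck`. -/
lemma cosArg_eq {b c lam : ℝ} (y : ℝ) (hc : 0 < c) (hlb : 0 < lam * b) (k : ℕ) :
    cosArg b c lam y k = -1 / (64 * (y : ℂ) ^ 2) * ((lam * b + c * k : ℝ) : ℂ) ^ 4 := by
  have hcc : (c : ℂ) ≠ 0 := by exact_mod_cast hc.ne'
  have hz : 0 < ((lam : ℂ) * b / c).re := by
    rw [← Complex.ofReal_mul, ← Complex.ofReal_div, Complex.ofReal_re]; positivity
  have hp := poch_ne_zero (ne_neg_natCast_of_re_pos hz) k
  have h := poch_add_one_mul ((lam : ℂ) * b / c) k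
  have h1 : ((lam : ℂ) * b + c) / c = lam * b / c + 1 := by field_simp
  rw [cosArg, h1]
  congr 2
  rw [div_eq_iff hp]
  push_cast
  have h2 : (lam : ℂ) * b = c * (lam * b / c) := by field_simp
  calc (lam : ℂ) * b * poch (lam * b / c + 1) k
      = c * (poch (lam * b / c + 1) k * (lam * b / c)) := by field_simp
    _ = _ := by rw [h]; field_simp

theorem integral_eq_cosInner {υ : ℂ} (hυ : 0 < υ.re) {b c lam y : ℝ} (hc : 0 < c) (hy : 0 < y)
    (hlb : 0 < lam * b) (k : ℕ) :
    ∫ x in Ioi (0 : ℝ), (x : ℂ) ^ (υ - 1) * (Real.exp (-(lam * b + c * k) * √x) : ℂ) *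
      (Real.cos (x * y) : ℂ) = (y : ℂ) ^ (-υ) * cosInner υ b c lam y k := by
  rw [integral_cpow_mul_exp_sqrt_mul_cos hυ (by positivity) hy, tsum_cosTerm hυ _ hy, cosInner]
  simp_rw [cosArg_eq y hc hlb, cosCoeff]
  push_cast
  rfl

/-! ### Termwise integration. -/

lemma integrable_tsum_of_summable_integral_norm {α : Type*} [MeasurableSpace α] {μ : Measure α}
    {F : ℕ → α → ℂ} (hF : ∀ k, Integrable (F k) μ)
    (hsum : Summable fun k => ∫ x, ‖F k x‖ ∂μ) (hpt : ∀ᵐ x ∂μ, Summable fun k => F k x) :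
    Integrable (fun x => ∑' k, F k x) μ := by
  refine ⟨?_, ?_⟩
  · refine aestronglyMeasurable_of_tendsto_ae atTop
      (f := fun n x => ∑ k ∈ Finset.range n, F k x) (fun n => ?_) ?_
    · exact Finset.aestronglyMeasurable_fun_sum _ fun k _ => (hF k).1
    · filter_upwards [hpt] with x hx using hx.hasSum.tendsto_sum_nat
  · rw [hasFiniteIntegral_iff_enorm]
    calc ∫⁻ x, ‖∑' k, F k x‖ₑ ∂μ ≤ ∫⁻ x, ∑' k, ‖F k x‖ₑ ∂μ :=
          lintegral_mono fun x => enorm_tsum_le_tsum_enorm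
      _ = ∑' k, ∫⁻ x, ‖F k x‖ₑ ∂μ := lintegral_tsum fun k => (hF k).1.enorm
      _ = ∑' k, ENNReal.ofReal (∫ x, ‖F k x‖ ∂μ) := by
          simp_rw [ofReal_integral_norm_eq_lintegral_enorm (hF _)]
      _ = ENNReal.ofReal (∑' k, ∫ x, ‖F k x‖ ∂μ) :=
          (ENNReal.ofReal_tsum_of_nonneg
            (fun k => integral_nonneg fun x => norm_nonneg _) hsum).symm
      _ < ⊤ := ENNReal.ofReal_lt_top

/-- The exponential `e^(-t(k+1))` is eventually below `(k+1)^(-2σ)`. -/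
lemma summable_mul_exp_pow {θ : ℕ → ℂ} {σ : ℝ}
    (hθ : Summable fun k => ‖θ k‖ * ((k : ℝ) + 1) ^ (-2 * σ)) {t : ℝ} (ht : 0 < t) :
    Summable fun k => θ k * (Real.exp (-t) : ℂ) ^ k := by
  have hlim := (tendsto_rpow_mul_exp_neg_mul_atTop_nhds_zero (2 * σ) t ht).comp
    (tendsto_atTop_add_const_right atTop (1 : ℝ) tendsto_natCast_atTop_atTop)
  refine Summable.of_norm_bounded_eventually_nat (hθ.mul_left (Real.exp t)) ?_
  filter_upwards [hlim.eventually (gt_mem_nhds one_pos)] with k hk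
  have hk1 : (0 : ℝ) < k + 1 := by positivity
  simp only [Function.comp] at hk
  have e1 : ((k : ℝ) + 1) ^ (-2 * σ) = (((k : ℝ) + 1) ^ (2 * σ))⁻¹ := by
    rw [neg_mul, Real.rpow_neg hk1.le]
  have e2 : Real.exp (-t) ^ k = Real.exp t * Real.exp (-t * (k + 1)) := by
    rw [← Real.exp_nat_mul, ← Real.exp_add]; ring_nf
  have hpos : 0 < ((k : ℝ) + 1) ^ (2 * σ) := Real.rpow_pos_of_pos hk1 _
  have h3 : Real.exp (-t * (k + 1)) ≤ ((k : ℝ) + 1) ^ (-2 * σ) := by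
    rw [e1, ← one_div, le_div_iff₀ hpos, mul_comm]
    exact hk.le
  rw [norm_mul, norm_pow, Complex.norm_real, Real.norm_of_nonneg (Real.exp_pos _).le, e2]
  calc ‖θ k‖ * (Real.exp t * Real.exp (-t * (k + 1)))
      = Real.exp t * (‖θ k‖ * Real.exp (-t * (k + 1))) := by ring
    _ ≤ _ := by gcongr

/-- With `a = λb + ck`, the power `a^(-2s)` is the source of the weight `(k+1)^(-2 Re υ)`. -/
lemma integral_rpow_mul_exp_neg_mul_sqrt {s a : ℝ} (hs : 0 < s) (ha : 0 < a) :
    ∫ x in Ioi (0 : ℝ), x ^ (s - 1) * Real.exp (-a * √x) =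
      2 * Real.Gamma (2 * s) * a ^ (-2 * s) := by
  have h := integral_rpow_mul_exp_neg_mul_rpow (p := 1 / 2) (q := s - 1) (b := a) (by norm_num)
    (by linarith) ha
  simp only [Real.sqrt_eq_rpow]
  rw [h, sub_add_cancel]
  rw [show -s / (1 / 2) = -2 * s by ring, show s / (1 / 2) = 2 * s by ring]
  ring

/-- Termwise integration of a power series in `e^(-c√x)`. -/
theorem integral_tsum_mul_exp_sqrt {υ : ℂ} (hυ : 0 < υ.re) {b c lam y : ℝ} (hc : 0 < c)
    (hy : 0 < y) (hlb : 0 < lam * b) {θ : ℕ → ℂ}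
    (hθ : Summable fun k => ‖θ k‖ * ((k : ℝ) + 1) ^ (-2 * υ.re)) :
    (∀ x : ℝ, 0 < x → Summable fun k => θ k * (Real.exp (-c * √x) : ℂ) ^ k) ∧
    IntegrableOn (fun x : ℝ => (x : ℂ) ^ (υ - 1) * (Real.exp (-b * lam * √x) : ℂ) *
      (∑' k, θ k * (Real.exp (-c * √x) : ℂ) ^ k) * (Real.cos (x * y) : ℂ)) (Ioi 0) ∧
    Summable (fun k => θ k * cosInner υ b c lam y k) ∧
    ∫ x in Ioi (0 : ℝ), (x : ℂ) ^ (υ - 1) * (Real.exp (-b * lam * √x) : ℂ) *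
      (∑' k, θ k * (Real.exp (-c * √x) : ℂ) ^ k) * (Real.cos (x * y) : ℂ) =
        (y : ℂ) ^ (-υ) * ∑' k, θ k * cosInner υ b c lam y k := by
  have hpt : ∀ x : ℝ, 0 < x → Summable fun k => θ k * (Real.exp (-c * √x) : ℂ) ^ k :=
    fun x hx => by
      simpa only [neg_mul] using summable_mul_exp_pow hθ (mul_pos hc (Real.sqrt_pos.2 hx))
  set F : ℕ → ℝ → ℂ := fun k x => θ k * ((x : ℂ) ^ (υ - 1) *
    (Real.exp (-(lam * b + c * k) * √x) : ℂ) * (Real.cos (x * y) : ℂ)) with hF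
  have hFx : ∀ k x, F k x = (x : ℂ) ^ (υ - 1) * (Real.exp (-b * lam * √x) : ℂ) *
      (Real.cos (x * y) : ℂ) * (θ k * (Real.exp (-c * √x) : ℂ) ^ k) := fun k x => by
    have : Real.exp (-(lam * b + c * k) * √x) =
        Real.exp (-b * lam * √x) * Real.exp (-c * √x) ^ k := by
      rw [← Real.exp_nat_mul, ← Real.exp_add]; ring_nf
    simp only [hF, this]
    push_cast
    ring
  have hFsum : ∀ x, ∑' k, F k x = (x : ℂ) ^ (υ - 1) * (Real.exp (-b * lam * √x) : ℂ) *
      (∑' k, θ k * (Real.exp (-c * √x) : ℂ) ^ k) * (Real.cos (x * y) : ℂ) := fun x => by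
    simp_rw [hFx]
    rw [tsum_mul_left]
    ring
  have ha : ∀ k : ℕ, 0 < lam * b + c * k := fun k => by positivity
  have hFle : ∀ k, ∀ x ∈ Ioi (0 : ℝ),
      ‖F k x‖ ≤ ‖θ k‖ * (x ^ (υ.re - 1) * Real.exp (-(lam * b + c * k) * √x)) := fun k x hx => by
    have hx' : 0 < x := hx
    simp only [hF]
    rw [norm_mul, norm_mul, norm_cpow_mul_exp_neg_mul_sqrt _ _ hx', Complex.norm_real]
    refine mul_le_mul_of_nonneg_left ?_ (norm_nonneg _)
    exact mul_le_of_le_one_right (by positivity) (Real.abs_cos_le_one _)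
  have hbint : ∀ k : ℕ, IntegrableOn
      (fun x : ℝ => ‖θ k‖ * (x ^ (υ.re - 1) * Real.exp (-(lam * b + c * k) * √x))) (Ioi 0) :=
    fun k => (integrableOn_rpow_mul_exp_neg_mul_sqrt (by linarith) (ha k)).const_mul _
  have hFint : ∀ k, IntegrableOn (F k) (Ioi 0) := fun k => by
    refine (hbint k).mono' (Measurable.aestronglyMeasurable (by simp only [hF]; fun_prop)) ?_
    filter_upwards [ae_restrict_mem measurableSet_Ioi] with x hx using hFle k x hx
  -- Chosen so that `m (k+1) ≤ λb + ck` for all `k`, including `k = 0`.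
  set m := min (lam * b) c with hm
  have hmpos : 0 < m := lt_min hlb hc
  have hFnorm : Summable fun k => ∫ x in Ioi (0 : ℝ), ‖F k x‖ := by
    refine (hθ.mul_left (2 * Real.Gamma (2 * υ.re) * m ^ (-2 * υ.re))).of_nonneg_of_le
      (fun k => integral_nonneg fun x => norm_nonneg _) fun k => ?_
    refine (setIntegral_mono_on (hFint k).norm (hbint k) measurableSet_Ioi (hFle k)).trans ?_
    rw [integral_const_mul, integral_rpow_mul_exp_neg_mul_sqrt hυ (ha k)]
    have hG : 0 < Real.Gamma (2 * υ.re) := Real.Gamma_pos_of_pos (by positivity)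
    have hk : (0 : ℝ) ≤ k := Nat.cast_nonneg k
    have h1 : m * (k + 1) ≤ lam * b + c * k := by
      nlinarith [min_le_left (lam * b) c, mul_le_mul_of_nonneg_right (min_le_right (lam * b) c) hk]
    have h2 : (lam * b + c * k) ^ (-2 * υ.re) ≤ m ^ (-2 * υ.re) * ((k : ℝ) + 1) ^ (-2 * υ.re) := by
      rw [← Real.mul_rpow hmpos.le (by positivity)]
      exact Real.rpow_le_rpow_of_nonpos (by positivity) h1 (by linarith)
    calc _ ≤ ‖θ k‖ * (2 * Real.Gamma (2 * υ.re) *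
          (m ^ (-2 * υ.re) * ((k : ℝ) + 1) ^ (-2 * υ.re))) := by gcongr
      _ = _ := by ring
  have hhas := hasSum_integral_of_summable_integral_norm hFint hFnorm
  have hI : ∀ k, ∫ x in Ioi (0 : ℝ), F k x =
      (y : ℂ) ^ (-υ) * (θ k * cosInner υ b c lam y k) := fun k => by
    simp only [hF]
    rw [integral_const_mul, integral_eq_cosInner hυ hc hy hlb]
    ring
  simp_rw [hI, hFsum] at hhas
  have hyc : (y : ℂ) ^ (-υ) ≠ 0 := by
    rw [Complex.cpow_ne_zero_iff]; left; exact_mod_cast hy.ne'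
  refine ⟨hpt, ?_, (summable_mul_left_iff hyc).1 hhas.summable, ?_⟩
  · have := integrable_tsum_of_summable_integral_norm hFint hFnorm (by
      filter_upwards [ae_restrict_mem measurableSet_Ioi] with x hx
      simp_rw [hFx]
      exact (hpt x hx).mul_left _)
    simp_rw [hFsum] at this
    exact this
  · rw [← hhas.tsum_eq, tsum_mul_left]

/-! ### Stirling bounds for Gamma along arithmetic progressions. -/

lemma exists_abs_log_Gamma_natCast_sub_le :
    ∃ C : ℝ, ∀ n : ℕ, n ≠ 0 →
      |Real.log (Real.Gamma n) - ((n - 1 / 2) * Real.log n - n)| ≤ C := by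
  have h := Stirling.tendsto_stirlingSeq_sqrt_pi.log (by positivity)
  obtain ⟨C, hC⟩ := isBounded_iff_forall_norm_le.1 (Metric.isBounded_range_of_tendsto _ h)
  refine ⟨C + |Real.log 2 / 2|, fun n hn => ?_⟩
  have hn' : (0 : ℝ) < n := by positivity
  have h1 : ‖Real.log (Stirling.stirlingSeq n)‖ ≤ C := hC _ ⟨n, rfl⟩
  have h2 : Real.log (n.factorial : ℝ) = Real.log (Real.Gamma n) + Real.log n := by
    rw [← Real.Gamma_nat_eq_factorial, Real.Gamma_add_one hn'.ne',
      Real.log_mul hn'.ne' (Real.Gamma_pos_of_pos hn').ne', add_comm]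
  rw [Stirling.log_stirlingSeq_formula, h2, Real.log_mul two_ne_zero hn'.ne',
    Real.log_div hn'.ne' (Real.exp_pos 1).ne', Real.log_exp, Real.norm_eq_abs] at h1
  refine le_trans (le_of_eq ?_) ((abs_add_le _ _).trans (add_le_add_left h1 _))
  congr 1
  ring

/-- Stirling's formula for `log Γ`, up to a bounded error. -/
lemma exists_abs_log_Gamma_sub_le :
    ∃ C : ℝ, ∀ u : ℝ, 3 ≤ u →
      |Real.log (Real.Gamma u) - ((u - 1 / 2) * Real.log u - u)| ≤ C := by
  obtain ⟨C, hC⟩ := exists_abs_log_Gamma_natCast_sub_le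
  refine ⟨C + 3, fun u hu => ?_⟩
  -- Taking `⌈u⌉ - 1` instead of the floor puts `θ = u - n` in `(0, 1]`, as the Bohr–Mollerup bounds
  -- need. They give `θ log(n-1) ≤ log Γ(u) - log Γ(n) ≤ θ log n`; the extra `3` is `1` for this gap
  -- plus `2` from `hlu2`.
  obtain ⟨n, hn⟩ : ∃ n : ℕ, ⌈u⌉₊ = n + 1 :=
    ⟨⌈u⌉₊ - 1, (Nat.succ_pred_eq_of_pos (Nat.ceil_pos.2 (by linarith))).symm⟩
  have hu1 : u ≤ n + 1 := by
    have := Nat.le_ceil u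
    rw [hn] at this
    exact_mod_cast this
  have hu2 : (n : ℝ) < u := Nat.lt_ceil.1 (by omega)
  have hn2 : (2 : ℝ) ≤ n := by linarith
  have hn2' : 2 ≤ n := by exact_mod_cast hn2
  set θ := u - n with hθ
  have huθ : u = n + θ := by rw [hθ]; ring
  have hθ0 : 0 < θ := by linarith
  have hθ1 : θ ≤ 1 := by linarith
  have hfeq : ∀ {y : ℝ}, 0 < y →
      (Real.log ∘ Real.Gamma) (y + 1) = (Real.log ∘ Real.Gamma) y + Real.log y := fun {y} hy => by
    simp only [Function.comp]
    rw [Real.Gamma_add_one hy.ne', Real.log_mul hy.ne' (Real.Gamma_pos_of_pos hy).ne', add_comm]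
  have hle := Real.BohrMollerup.f_add_nat_le Real.convexOn_log_Gamma hfeq (by omega) hθ0 hθ1
    (n := n)
  have hge := Real.BohrMollerup.f_add_nat_ge Real.convexOn_log_Gamma hfeq hn2' hθ0
  simp only [Function.comp, ← huθ] at hle hge
  have hlog : Real.log n - Real.log (n - 1) ≤ 1 := by
    have h1 : Real.log n ≤ Real.log (2 * (n - 1)) := Real.log_le_log (by linarith) (by linarith)
    rw [Real.log_mul two_ne_zero (by linarith)] at h1
    have := Real.log_two_lt_d9
    linarith
  have hlog0 : 0 ≤ Real.log n - Real.log (n - 1) :=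
    sub_nonneg.2 (Real.log_le_log (by linarith) (by linarith))
  have hlu0 : 0 ≤ Real.log u - Real.log n :=
    sub_nonneg.2 (Real.log_le_log (by linarith) hu2.le)
  have hlu1 : (Real.log u - Real.log n) * n ≤ 1 := by
    rw [← Real.log_div (by linarith) (by linarith)]
    have := Real.log_le_sub_one_of_pos (show 0 < u / n by positivity)
    calc Real.log (u / n) * n ≤ (u / n - 1) * n := by gcongr
      _ = u - n := by field_simp
      _ ≤ 1 := hθ1
  have hlu2 : (u - 1 / 2) * (Real.log u - Real.log n) ≤ 2 := by
    have : (u - 1 / 2) * (Real.log u - Real.log n) ≤ (2 * n) * (Real.log u - Real.log n) :=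
      mul_le_mul_of_nonneg_right (by linarith) hlu0
    linarith
  have hlu3 : 0 ≤ (u - 1 / 2) * (Real.log u - Real.log n) := mul_nonneg (by linarith) hlu0
  have hθl : θ * (Real.log n - Real.log (n - 1)) ≤ 1 := mul_le_one₀ hθ1 hlog0 hlog
  have hCn := abs_le.1 (hC n (by omega))
  have key : (u - 1 / 2) * Real.log u - u - ((n - 1 / 2) * Real.log n - n + θ * Real.log n) =
      (u - 1 / 2) * (Real.log u - Real.log n) - θ := by rw [huθ]; ring
  rw [abs_le]
  constructor <;> linarith

/-- For fixed `y`, the ratio `|Γ(x+iy)| / Γ(x)` increases with `x > 0`. -/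
lemma norm_Gamma_mul_le {x x' : ℝ} (hx : 0 < x) (hxx : x ≤ x') (y : ℝ) :
    ‖Complex.Gamma (x + y * Complex.I)‖ * Real.Gamma x' ≤
      ‖Complex.Gamma (x' + y * Complex.I)‖ * Real.Gamma x := by
  -- By Euler's limit the ratio is the limit of `∏ (x+j) / |x+j+iy|`, and each factor increases with
  -- `x`.
  refine le_of_tendsto_of_tendsto
    ((Complex.GammaSeq_tendsto_Gamma _).norm.mul (Real.GammaSeq_tendsto_Gamma x'))
    ((Complex.GammaSeq_tendsto_Gamma _).norm.mul (Real.GammaSeq_tendsto_Gamma x)) ?_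
  filter_upwards [eventually_gt_atTop 0] with n hn
  have hn' : (0 : ℝ) < n := by exact_mod_cast hn
  have hx' : 0 < x' := hx.trans_le hxx
  have hnorm : ∀ t : ℝ, ‖Complex.GammaSeq (t + y * Complex.I) n‖ = (n : ℝ) ^ t * n.factorial /
      ∏ j ∈ Finset.range (n + 1), ‖(t : ℂ) + y * Complex.I + j‖ := fun t => by
    rw [Complex.GammaSeq, norm_div, norm_mul, norm_prod, Complex.norm_natCast,
      ← Complex.ofReal_natCast, Complex.norm_cpow_eq_rpow_re_of_pos hn']
    simp
  have hsq : ∀ (t : ℝ) (j : ℕ), ‖(t : ℂ) + y * Complex.I + j‖ = √((t + j) ^ 2 + y ^ 2) :=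
    fun t j => by
      rw [Complex.norm_eq_sqrt_sq_add_sq]
      simp
  have hpos : ∀ (t : ℝ), 0 < t → 0 < ∏ j ∈ Finset.range (n + 1), ‖(t : ℂ) + y * Complex.I + j‖ :=
    fun t ht => Finset.prod_pos fun j _ => by
      rw [hsq]; positivity
  have hpos' : ∀ (t : ℝ), 0 < t → 0 < ∏ j ∈ Finset.range (n + 1), (t + j) :=
    fun t ht => Finset.prod_pos fun j _ => by positivity
  rw [hnorm, hnorm, Real.GammaSeq, Real.GammaSeq, div_mul_div_comm, div_mul_div_comm]
  have h1 := hpos x hx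
  have h2 := hpos x' hx'
  have h3 := hpos' x hx
  have h4 := hpos' x' hx'
  rw [div_le_div_iff₀ (by positivity) (by positivity)]
  have hle : (∏ j ∈ Finset.range (n + 1), ‖(x' : ℂ) + y * Complex.I + j‖) *
      ∏ j ∈ Finset.range (n + 1), (x + j) ≤
      (∏ j ∈ Finset.range (n + 1), ‖(x : ℂ) + y * Complex.I + j‖) *
      ∏ j ∈ Finset.range (n + 1), (x' + j) := by
    rw [← Finset.prod_mul_distrib, ← Finset.prod_mul_distrib]
    refine Finset.prod_le_prod (fun j _ => by positivity) fun j _ => ?_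
    rw [hsq, hsq]
    have e : ∀ s t : ℝ, 0 ≤ t → √s * t = √(s * t ^ 2) := fun s t ht => by
      rw [Real.sqrt_mul' _ (sq_nonneg t), Real.sqrt_sq ht]
    rw [e _ _ (by positivity), e _ _ (by positivity)]
    apply Real.sqrt_le_sqrt
    have : (x + j) ^ 2 ≤ (x' + j) ^ 2 := by gcongr
    nlinarith [mul_le_mul_of_nonneg_left this (sq_nonneg y)]
  calc _ = (n : ℝ) ^ x * n.factorial * ((n : ℝ) ^ x' * n.factorial) * _ := rfl
    _ ≤ (n : ℝ) ^ x * n.factorial * ((n : ℝ) ^ x' * n.factorial) * _ :=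
        mul_le_mul_of_nonneg_left hle (by positivity)
    _ = _ := by ring

/-- The logarithm of the order of growth of `Γ(α + kA)` with `Re α = a`. -/
noncomputable def logGrowth (a A : ℝ) (k : ℕ) : ℝ :=
  k * A * Real.log k + k * (A * Real.log |A|) - k * A + (a - 1 / 2) * Real.log k

/-- Write `log(a+kA) = log k + log A + log(1 + a/(kA))` and use `t log(1 + a/t) → a`, which cancels
the `-a`. -/
lemma tendsto_stirling_sub_logGrowth (a : ℝ) {A : ℝ} (hA : 0 < A) :
    Tendsto (fun k : ℕ => (a + k * A - 1 / 2) * Real.log (a + k * A) - (a + k * A) -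
      logGrowth a A k) atTop (𝓝 ((a - 1 / 2) * Real.log A)) := by
  have hk : Tendsto (fun k : ℕ => (k : ℝ) * A) atTop atTop :=
    tendsto_natCast_atTop_atTop.atTop_mul_const hA
  have h1 := (Real.tendsto_mul_log_one_add_div_atTop a).comp hk
  have h2 : Tendsto (fun k : ℕ => Real.log (1 + a / (k * A))) atTop (𝓝 0) := by
    have := ((tendsto_const_nhds (x := a)).div_atTop hk).const_add 1
    rw [add_zero] at this
    simpa using this.log one_ne_zero
  have h3 := ((h1.add (h2.const_mul (a - 1 / 2))).sub_const a).add_const ((a - 1 / 2) * Real.log A)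
  simp only [mul_zero, add_zero, sub_self, zero_add] at h3
  refine h3.congr' ?_
  filter_upwards [eventually_gt_atTop 0, hk.eventually_gt_atTop (-a)] with k hk0 hka
  have hk0' : (0 : ℝ) < k := by exact_mod_cast hk0
  have e : Real.log (a + k * A) = Real.log k + Real.log A + Real.log (1 + a / (k * A)) := by
    have h5 : (0 : ℝ) < 1 + a / (k * A) := by
      rw [show 1 + a / (k * A) = (a + k * A) / (k * A) by field_simp; ring]
      exact div_pos (by linarith) (by positivity)
    rw [← Real.log_mul hk0'.ne' hA.ne', ← Real.log_mul (by positivity) h5.ne']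
    congr 1
    field_simp
    ring
  simp only [Function.comp, logGrowth, abs_of_pos hA]
  rw [e]
  ring

lemma Gamma_isTheta_exp_logGrowth (a : ℝ) {A : ℝ} (hA : 0 < A) :
    (fun k : ℕ => Real.Gamma (a + k * A)) =Θ[atTop] fun k => Real.exp (logGrowth a A k) := by
  obtain ⟨C, hC⟩ := exists_abs_log_Gamma_sub_le
  have hk : Tendsto (fun k : ℕ => a + (k : ℝ) * A) atTop atTop :=
    tendsto_atTop_add_const_left _ _ (tendsto_natCast_atTop_atTop.atTop_mul_const hA)
  have hb : ∀ᶠ k : ℕ in atTop, |Real.log (Real.Gamma (a + k * A)) - logGrowth a A k| ≤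
      C + (|(a - 1 / 2) * Real.log A| + 1) := by
    filter_upwards [hk.eventually_ge_atTop 3, (tendsto_stirling_sub_logGrowth a hA).abs.eventually
      (gt_mem_nhds (lt_add_one _))] with k h3 hlt
    refine le_trans (le_of_eq ?_) ((abs_add_le _ _).trans (add_le_add (hC _ h3) hlt.le))
    congr 1
    ring
  refine ⟨IsBigO.of_bound (Real.exp (C + (|(a - 1 / 2) * Real.log A| + 1))) ?_,
    IsBigO.of_bound (Real.exp (C + (|(a - 1 / 2) * Real.log A| + 1))) ?_⟩
  all_goals
    filter_upwards [hb, hk.eventually_gt_atTop 0] with k hk1 hk0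
    have hG := Real.Gamma_pos_of_pos hk0
    have := abs_le.1 hk1
    rw [Real.norm_of_nonneg hG.le, Real.norm_of_nonneg (Real.exp_pos _).le]
  · rw [← Real.exp_add, ← Real.log_le_iff_le_exp hG]
    linarith
  · rw [← Real.le_log_iff_exp_le (mul_pos (Real.exp_pos _) hG),
      Real.log_mul (Real.exp_pos _).ne' hG.ne', Real.log_exp]
    linarith

/-- Along the progression the imaginary part is fixed: `|Γ(s)| ≤ Γ(Re s)` bounds from above, and
comparison with real part `1` in `norm_Gamma_mul_le` bounds from below. -/
lemma complexGamma_isTheta_exp_logGrowth (α : ℂ) {A : ℝ} (hA : 0 < A) :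
    (fun k : ℕ => Complex.Gamma (α + (k : ℂ) * (A : ℂ))) =Θ[atTop]
      fun k => Real.exp (logGrowth α.re A k) := by
  refine IsTheta.trans ?_ (Gamma_isTheta_exp_logGrowth α.re hA)
  have hk : Tendsto (fun k : ℕ => α.re + (k : ℝ) * A) atTop atTop :=
    tendsto_atTop_add_const_left _ _ (tendsto_natCast_atTop_atTop.atTop_mul_const hA)
  have hre : ∀ k : ℕ, (α + (k : ℂ) * (A : ℂ)).re = α.re + k * A := fun k => by simp
  have hc : 0 < ‖Complex.Gamma ((1 : ℝ) + α.im * Complex.I)‖ :=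
    norm_pos_iff.2 (Complex.Gamma_ne_zero_of_re_pos (by simp))
  refine ⟨IsBigO.of_bound 1 ?_,
    IsBigO.of_bound ‖Complex.Gamma ((1 : ℝ) + α.im * Complex.I)‖⁻¹ ?_⟩
  · filter_upwards [hk.eventually_gt_atTop 0] with k h0
    rw [one_mul, Real.norm_of_nonneg (Real.Gamma_pos_of_pos h0).le, ← hre]
    exact norm_Gamma_le (by rwa [hre])
  · filter_upwards [hk.eventually_ge_atTop 1] with k h1
    rw [Real.norm_of_nonneg (Real.Gamma_pos_of_pos (by linarith)).le, inv_mul_eq_div,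
      le_div_iff₀ hc, mul_comm]
    have h := norm_Gamma_mul_le one_pos h1 α.im
    rw [Real.Gamma_one, mul_one] at h
    refine h.trans_eq ?_
    congr 2
    apply Complex.ext <;> simp

/-- The symmetry matching the reflection `z ↦ 1 - z`; it lets one growth formula serve both signs of
`A`. -/
lemma logGrowth_one_sub_neg (a A : ℝ) (k : ℕ) :
    logGrowth (1 - a) (-A) k = -logGrowth a A k := by
  simp only [logGrowth, abs_neg]
  ring

lemma complexGamma_one_sub_isTheta (α : ℂ) {A : ℝ} (hA : A < 0) :
    (fun k : ℕ => Complex.Gamma (1 - (α + (k : ℂ) * (A : ℂ)))) =Θ[atTop]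
      fun k => (Real.exp (logGrowth α.re A k))⁻¹ := by
  have h := complexGamma_isTheta_exp_logGrowth (1 - α) (neg_pos.2 hA)
  simp only [Complex.sub_re, Complex.one_re, logGrowth_one_sub_neg, Real.exp_neg] at h
  refine IsTheta.trans (EventuallyEq.isTheta (Eventually.of_forall fun k => ?_)) h
  simp only
  congr 1
  push_cast
  ring

lemma norm_sin_le_exp (z : ℂ) : ‖Complex.sin z‖ ≤ Real.exp |z.im| := by
  rw [Complex.sin]
  have h1 : ‖Complex.exp (-z * Complex.I)‖ ≤ Real.exp |z.im| := by
    rw [Complex.norm_exp]; simpa using le_abs_self _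
  have h2 : ‖Complex.exp (z * Complex.I)‖ ≤ Real.exp |z.im| := by
    rw [Complex.norm_exp]; simpa using neg_le_abs _
  have h3 := norm_sub_le (Complex.exp (-z * Complex.I)) (Complex.exp (z * Complex.I))
  rw [norm_div, norm_mul, Complex.norm_I, Complex.norm_two]
  linarith

/-- For `A < 0`, `1/Γ(z) = sin(πz) Γ(1-z)/π`, and the sine stays bounded since `Im z` is constant.
No distance from the poles is needed. -/
lemma inv_complexGamma_isBigO (α : ℂ) {A : ℝ} (hA : A ≠ 0) :
    (fun k : ℕ => (Complex.Gamma (α + (k : ℂ) * (A : ℂ)))⁻¹) =O[atTop]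
      fun k => (Real.exp (logGrowth α.re A k))⁻¹ := by
  rcases hA.lt_or_gt with hA | hA
  · refine IsBigO.trans (IsBigO.of_bound (Real.exp (Real.pi * |α.im|) / Real.pi) ?_)
      (complexGamma_one_sub_isTheta α hA).1
    have htend : Tendsto (fun k : ℕ => α.re + (k : ℝ) * A) atTop atBot :=
      tendsto_atBot_add_const_left _ _ (tendsto_natCast_atTop_atTop.atTop_mul_const_of_neg hA)
    filter_upwards [htend.eventually_lt_atBot 1] with k hk1
    have h := Complex.Gamma_mul_Gamma_one_sub (α + (k : ℂ) * (A : ℂ))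
    have hre : (α + (k : ℂ) * (A : ℂ)).re = α.re + k * A := by simp
    rw [← hre] at hk1
    set z := α + (k : ℂ) * (A : ℂ) with hz
    have him : (Real.pi * z).im = Real.pi * α.im := by simp [hz]
    have hG : Complex.Gamma (1 - z) ≠ 0 := Complex.Gamma_ne_zero_of_re_pos (by
      rw [Complex.sub_re, Complex.one_re]; linarith)
    rw [← eq_div_iff hG] at h
    have hs := norm_sin_le_exp (Real.pi * z)
    rw [him, abs_mul, abs_of_pos Real.pi_pos] at hs
    have h1 : (Complex.Gamma z)⁻¹ =
        Complex.sin (Real.pi * z) / Real.pi * Complex.Gamma (1 - z) := by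
      rw [h, inv_div, div_div_eq_mul_div]
      ring
    rw [h1, norm_mul, norm_div, Complex.norm_real, Real.norm_of_nonneg Real.pi_pos.le]
    gcongr
  · exact (complexGamma_isTheta_exp_logGrowth α hA).inv.1

/-- From `|sin(u+iv)|² = sin²u + sinh²v`, with Jordan's inequality for the sine and `sinh v ≥ v` for
`v ≥ 0`. -/
lemma two_mul_norm_le_norm_sin {w : ℂ} (hw : |w.re| ≤ 1 / 2) :
    2 * ‖w‖ ≤ ‖Complex.sin (Real.pi * w)‖ := by
  have hre : (Real.pi * w).re = Real.pi * w.re := by simp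
  have him : (Real.pi * w).im = Real.pi * w.im := by simp
  have h1 : 2 * |w.re| ≤ |Real.sin (Real.pi * w.re)| := by
    have := Real.mul_abs_le_abs_sin (x := Real.pi * w.re) (by
      rw [abs_mul, abs_of_pos Real.pi_pos]; nlinarith [Real.pi_pos])
    rw [abs_mul, abs_of_pos Real.pi_pos] at this
    calc 2 * |w.re| = 2 / Real.pi * (Real.pi * |w.re|) := by field_simp
      _ ≤ _ := this
  have h2 : 2 * |w.im| ≤ |Real.sinh (Real.pi * w.im)| := by
    rw [Real.abs_sinh, abs_mul, abs_of_pos Real.pi_pos]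
    have := Real.self_le_sinh_iff.2 (show 0 ≤ Real.pi * |w.im| by positivity)
    have h3 : 2 * |w.im| ≤ Real.pi * |w.im| :=
      mul_le_mul_of_nonneg_right Real.two_le_pi (abs_nonneg _)
    linarith
  have hsin : ‖Complex.sin (Real.pi * w)‖ ^ 2 =
      Real.sin (Real.pi * w.re) ^ 2 + Real.sinh (Real.pi * w.im) ^ 2 := by
    rw [Complex.sin_eq, hre, him, ← Complex.normSq_eq_norm_sq, ← Complex.ofReal_sin,
      ← Complex.ofReal_cos, ← Complex.ofReal_sinh, ← Complex.ofReal_cosh, ← Complex.ofReal_mul,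
      ← Complex.ofReal_mul, Complex.normSq_add_mul_I, mul_pow, mul_pow, Real.cosh_sq]
    nlinarith [Real.sin_sq_add_cos_sq (Real.pi * w.re)]
  refine le_of_sq_le_sq ?_ (norm_nonneg _)
  rw [hsin, mul_pow, ← Complex.normSq_eq_norm_sq, Complex.normSq_apply]
  have h3 := pow_le_pow_left₀ (by positivity) h1 2
  have h4 := pow_le_pow_left₀ (by positivity) h2 2
  rw [mul_pow, sq_abs, sq_abs] at h3 h4
  linarith

lemma complexGamma_isBigO (α : ℂ) {A : ℝ} (hA : A ≠ 0)
    (hpole : A < 0 → ∃ ε : ℝ, 0 < ε ∧ ∀ k n : ℕ, ε ≤ ‖α + (k : ℂ) * (A : ℂ) + (n : ℂ)‖) :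
    (fun k : ℕ => Complex.Gamma (α + (k : ℂ) * (A : ℂ))) =O[atTop]
      fun k => Real.exp (logGrowth α.re A k) := by
  rcases hA.lt_or_gt with hA | hA
  · obtain ⟨ε, hε, hk⟩ := hpole hA
    have h1 := (complexGamma_one_sub_isTheta α hA).inv.1
    simp only [inv_inv] at h1
    refine IsBigO.trans (IsBigO.of_bound (Real.pi / (2 * ε)) ?_) h1
    have htend : Tendsto (fun k : ℕ => α.re + (k : ℝ) * A) atTop atBot :=
      tendsto_atBot_add_const_left _ _ (tendsto_natCast_atTop_atTop.atTop_mul_const_of_neg hA)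
    filter_upwards [htend.eventually_lt_atBot (-1)] with k hk1
    have h := Complex.Gamma_mul_Gamma_one_sub (α + (k : ℂ) * (A : ℂ))
    have hkn := hk k
    have hre : (α + (k : ℂ) * (A : ℂ)).re = α.re + k * A := by simp
    rw [← hre] at hk1
    set z := α + (k : ℂ) * (A : ℂ) with hz
    -- Translating by the integer nearest to `Re z`, which is negative as `Re z < -1`, makes the
    -- sine bound applicable; the distance `ε` from the poles then gives `|sin(πz)| ≥ 2ε` in the
    -- reflection formula.
    obtain ⟨n, hn⟩ : ∃ n : ℕ, round z.re = -(n : ℤ) := by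
      have h2 := abs_le.1 (abs_sub_round z.re)
      have h3 : ((round z.re : ℤ) : ℝ) < 0 := by linarith
      have h4 : round z.re < 0 := by exact_mod_cast h3
      exact ⟨(-round z.re).toNat, by omega⟩
    have hw : |(z + n).re| ≤ 1 / 2 := by
      have h2 := abs_sub_round z.re
      rw [hn] at h2
      simpa using h2
    have hsin : 2 * ε ≤ ‖Complex.sin (Real.pi * z)‖ := by
      have h2 := two_mul_norm_le_norm_sin hw
      have h3 : ‖Complex.sin (Real.pi * (z + n))‖ = ‖Complex.sin (Real.pi * z)‖ := by
        rw [mul_add, mul_comm (Real.pi : ℂ) n, Complex.sin_antiperiodic.add_nat_mul_eq n]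
        simp
      rw [h3] at h2
      linarith [hkn n]
    have hG : Complex.Gamma (1 - z) ≠ 0 := Complex.Gamma_ne_zero_of_re_pos (by
      rw [Complex.sub_re, Complex.one_re]; linarith)
    rw [← eq_div_iff hG] at h
    rw [h, norm_div, norm_div, norm_inv, Complex.norm_real, Real.norm_of_nonneg Real.pi_pos.le,
      div_eq_mul_inv _ ‖Complex.Gamma (1 - z)‖]
    gcongr
  · exact (complexGamma_isTheta_exp_logGrowth α hA).1

/-! ### Summability of the Fox–Wright coefficients. -/

lemma tendsto_log_div_natCast : Tendsto (fun k : ℕ => Real.log k / k) atTop (𝓝 0) :=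
  Real.isLittleO_log_id_atTop.tendsto_div_nhds_zero.comp tendsto_natCast_atTop_atTop

lemma summable_exp_neg_of_eventually_le {g : ℕ → ℝ} {r : ℝ} (hr : 0 < r)
    (h : ∀ᶠ k : ℕ in atTop, g k ≤ -(k * r)) : Summable fun k => Real.exp (g k) := by
  refine Summable.of_norm_bounded_eventually_nat (Real.summable_exp_nat_mul_iff.2 (neg_lt_zero.2 hr))
    (h.mono fun k hk => ?_)
  rw [Real.norm_of_nonneg (Real.exp_pos _).le, mul_neg]
  exact Real.exp_le_exp.2 hk

/-- Used with `D = Δ* + 1`, `l = log δ*` and `q = Re μ* + 1/2 + 2 Re υ`: the cases are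
superexponential decay, geometric decay, and the series of `k^(-q)`. -/
lemma summable_exp_stirling {D l q : ℝ}
    (h : 0 < D ∨ (D = 0 ∧ 0 < l) ∨ (D = 0 ∧ l = 0 ∧ 1 < q)) :
    Summable fun k : ℕ => Real.exp (-(D * (k * Real.log k)) - k * l + D * k - q * Real.log k) := by
  have hlog := (tendsto_log_div_natCast.const_mul q)
  rw [mul_zero] at hlog
  rcases h with hD | ⟨rfl, hl⟩ | ⟨rfl, rfl, hq⟩
  · refine summable_exp_neg_of_eventually_le one_pos ?_
    have h1 : Tendsto (fun k : ℕ => D * Real.log k) atTop atTop :=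
      (Real.tendsto_log_atTop.comp tendsto_natCast_atTop_atTop).const_mul_atTop hD
    filter_upwards [eventually_gt_atTop 0, h1.eventually_ge_atTop (2 - l + D),
      hlog.eventually (lt_mem_nhds (by norm_num : (-1 : ℝ) < 0))] with k hk h2 h3
    have hk' : (0 : ℝ) < k := by exact_mod_cast hk
    have e : q * Real.log k = k * (q * (Real.log k / k)) := by field_simp
    rw [e]
    have : 0 ≤ k * (D * Real.log k + l - D + q * (Real.log k / k) - 1) :=
      mul_nonneg hk'.le (by linarith)
    linarith
  · refine summable_exp_neg_of_eventually_le (half_pos hl) ?_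
    filter_upwards [eventually_gt_atTop 0,
      hlog.eventually (lt_mem_nhds (by linarith : -(l / 2) < 0))] with k hk h3
    have hk' : (0 : ℝ) < k := by exact_mod_cast hk
    have e : q * Real.log k = k * (q * (Real.log k / k)) := by field_simp
    rw [e]
    have : 0 ≤ k * (l / 2 + q * (Real.log k / k)) := mul_nonneg hk'.le (by linarith)
    linarith
  · refine Summable.of_norm_bounded_eventually_nat (Real.summable_nat_rpow.2 (neg_lt_neg hq)) ?_
    filter_upwards [eventually_gt_atTop 0] with k hk
    have hk' : (0 : ℝ) < k := by exact_mod_cast hk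
    rw [Real.norm_of_nonneg (Real.exp_pos _).le, Real.rpow_def_of_pos hk']
    refine le_of_eq ?_
    congr 1
    ring

lemma log_fwRadius {r s : ℕ} {A : Fin r → ℝ} {B : Fin s → ℝ} (hA : ∀ i, A i ≠ 0)
    (hB : ∀ j, B j ≠ 0) :
    Real.log (fwRadius A B) = ∑ j, B j * Real.log |B j| - ∑ i, A i * Real.log |A i| := by
  have hA' : ∀ i, |A i| ^ (-A i) ≠ 0 := fun i => (Real.rpow_pos_of_pos (abs_pos.2 (hA i)) _).ne'
  have hB' : ∀ j, |B j| ^ B j ≠ 0 := fun j => (Real.rpow_pos_of_pos (abs_pos.2 (hB j)) _).ne'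
  rw [fwRadius, Real.log_mul (Finset.prod_ne_zero_iff.2 fun i _ => hA' i)
    (Finset.prod_ne_zero_iff.2 fun j _ => hB' j), Real.log_prod (fun i _ => hA' i),
    Real.log_prod (fun j _ => hB' j)]
  simp_rw [Real.log_rpow (abs_pos.2 (hA _)), Real.log_rpow (abs_pos.2 (hB _))]
  simp only [neg_mul, Finset.sum_neg_distrib]
  ring

lemma sum_logGrowth {m : ℕ} (a : Fin m → ℂ) (A : Fin m → ℝ) (k : ℕ) :
    ∑ i, logGrowth (a i).re (A i) k = (∑ i, A i) * (k * Real.log k) +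
      k * (∑ i, A i * Real.log |A i|) - k * (∑ i, A i) +
      ((∑ i, a i).re - m / 2) * Real.log k := by
  simp only [logGrowth, Finset.sum_add_distrib, Finset.sum_sub_distrib, ← Finset.sum_mul,
    ← Finset.mul_sum, Complex.re_sum, Finset.sum_const, Finset.card_univ, Fintype.card_fin,
    nsmul_eq_mul]
  ring

lemma foxWrightCoeff_div_factorial_isBigO {r s : ℕ} {α : Fin r → ℂ} {A : Fin r → ℝ}
    {β : Fin s → ℂ} {B : Fin s → ℝ} (hA : ∀ i, A i ≠ 0) (hB : ∀ j, B j ≠ 0)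
    (hα : AwayFromPoles α A) :
    (fun k : ℕ => foxWrightCoeff α A β B k / (k.factorial : ℂ)) =O[atTop] fun k : ℕ =>
      Real.exp (-((fwDelta A B + 1) * (k * Real.log k)) - k * Real.log (fwRadius A B) +
        (fwDelta A B + 1) * k - ((fwMu α β).re + 1 / 2) * Real.log k) := by
  have h1 := IsBigO.finsetProd (s := Finset.univ)
    fun i _ => complexGamma_isBigO (α i) (hA i) (hα i)
  have h2 := IsBigO.finsetProd (s := Finset.univ)
    fun j _ => inv_complexGamma_isBigO (β j) (hB j)
  -- The factor `1/k!` counts as one more denominator `Γ(1 + k)`; it accounts for the `+ 1` beside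
  -- `Δ*` and the `+ 1/2` beside `μ*`.
  have h3 := inv_complexGamma_isBigO 1 one_ne_zero
  refine ((h1.mul h2).mul h3).congr (fun k => ?_) (fun k => ?_)
  · rw [foxWrightCoeff, Finset.prod_inv_distrib, div_eq_mul_inv, div_eq_mul_inv,
      ← Complex.Gamma_nat_eq_factorial]
    congr 3
    push_cast
    ring
  · simp_rw [← Real.exp_neg, ← Real.exp_sum]
    rw [← Real.exp_add, ← Real.exp_add, Finset.sum_neg_distrib, sum_logGrowth, sum_logGrowth,
      log_fwRadius hA hB]
    congr 1
    simp only [logGrowth, fwDelta, fwMu]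
    simp
    ring

theorem foxWrightSummable_of_conditions {r s : ℕ} {υ : ℂ} (hυ : 0 < υ.re) {α : Fin r → ℂ}
    {A : Fin r → ℝ} {β : Fin s → ℂ} {B : Fin s → ℝ} (hA : ∀ i, A i ≠ 0) (hB : ∀ j, B j ≠ 0)
    (h : FoxWrightConditions υ α A β B) : FoxWrightSummable υ α A β B := by
  obtain ⟨hα, hcond⟩ := h
  have hpow : (fun k : ℕ => ((k : ℝ) + 1) ^ (-2 * υ.re)) =O[atTop]
      fun k : ℕ => Real.exp (-(2 * υ.re * Real.log k)) := by
    refine IsBigO.of_bound 1 ?_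
    filter_upwards [eventually_gt_atTop 0] with k hk
    have hk' : (0 : ℝ) < k := by exact_mod_cast hk
    rw [one_mul, Real.norm_of_nonneg (by positivity), Real.norm_of_nonneg (Real.exp_pos _).le]
    refine (Real.rpow_le_rpow_of_nonpos hk' (by linarith : (k : ℝ) ≤ k + 1)
      (by linarith)).trans_eq ?_
    rw [Real.rpow_def_of_pos hk']
    congr 1
    ring
  have hO := (foxWrightCoeff_div_factorial_isBigO (β := β) hA hB hα).norm_left.mul hpow
  refine summable_of_isBigO_nat ?_ (hO.congr_left fun k => by simp)
  simp_rw [← Real.exp_add]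
  refine (summable_exp_stirling (D := fwDelta A B + 1) (l := Real.log (fwRadius A B))
    (q := (fwMu α β).re + 1 / 2 + 2 * υ.re) ?_).congr fun k => ?_
  · rcases hcond with h | ⟨h, h'⟩ | ⟨h, h', h''⟩
    · exact Or.inl (by linarith)
    · exact Or.inr (Or.inl ⟨by linarith, Real.log_pos h'⟩)
    · exact Or.inr (Or.inr ⟨by linarith, by rw [h', Real.log_one], by linarith⟩)
  · congr 1
    ring

/-! ### The hypergeometric case. -/

lemma foxWrightCoeff_one_eq {r s : ℕ} {α : Fin r → ℂ} {β : Fin s → ℂ}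
    (hα : ∀ (i : Fin r) (n : ℕ), α i ≠ -(n : ℂ)) (hβ : ∀ (j : Fin s) (n : ℕ), β j ≠ -(n : ℂ))
    (k : ℕ) :
    foxWrightCoeff α (fun _ => 1) β (fun _ => 1) k =
      (∏ i, Complex.Gamma (α i)) / (∏ j, Complex.Gamma (β j)) *
        ((∏ i, poch (α i) k) / ∏ j, poch (β j) k) := by
  simp only [foxWrightCoeff, Complex.ofReal_one, mul_one, Gamma_add_natCast (hα _),
    Gamma_add_natCast (hβ _), Finset.prod_mul_distrib]
  rw [div_mul_div_comm, mul_comm (∏ i, poch (α i) k), mul_comm (∏ j, poch (β j) k)]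

lemma integralJ_one_eq {r s : ℕ} {α : Fin r → ℂ} {β : Fin s → ℂ}
    (hα : ∀ (i : Fin r) (n : ℕ), α i ≠ -(n : ℂ)) (hβ : ∀ (j : Fin s) (n : ℕ), β j ≠ -(n : ℂ))
    (υ : ℂ) (b c lam y : ℝ) :
    integralJ α (fun _ => 1) β (fun _ => 1) υ b c lam y =
      (∏ i, Complex.Gamma (α i)) / (∏ j, Complex.Gamma (β j)) * integralK α β υ b c lam y := by
  have h : ∀ z : ℂ, foxWright α (fun _ => 1) β (fun _ => 1) z =
      (∏ i, Complex.Gamma (α i)) / (∏ j, Complex.Gamma (β j)) * pFq α β z := fun z => by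
    rw [foxWright, pFq, ← tsum_mul_left]
    refine tsum_congr fun k => ?_
    rw [foxWrightTerm, pFqTerm, foxWrightCoeff_one_eq hα hβ, mul_assoc]
  rw [integralJ, integralK, ← integral_const_mul]
  refine integral_congr_ae (ae_of_all _ fun x => ?_)
  simp only [integrandJ, integrandK, h]
  ring

lemma poch_neg_natCast_eq_zero {n k : ℕ} (h : n < k) : poch (-(n : ℂ)) k = 0 := by
  induction k with
  | zero => omega
  | succ k ih =>
    rw [poch_succ]
    rcases Nat.lt_succ_iff_lt_or_eq.1 h with h' | rfl
    · rw [ih h', zero_mul]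
    · rw [neg_add_cancel, mul_zero]

lemma summable_pFq_coeff {r s : ℕ} {υ : ℂ} (hυ : 0 < υ.re) {α : Fin r → ℂ} {β : Fin s → ℂ}
    (hβ : ∀ (j : Fin s) (n : ℕ), β j ≠ -(n : ℂ)) (hrs : r ≤ s + 1)
    (hre : r = s + 1 → 0 < (2 * υ + (∑ j, β j - ∑ i, α i)).re ∨
      ∃ (i : Fin r) (n : ℕ), α i = -(n : ℂ)) :
    Summable fun k : ℕ => ‖(∏ i, poch (α i) k) / ((∏ j, poch (β j) k) * (k.factorial : ℂ))‖ *
      ((k : ℝ) + 1) ^ (-2 * υ.re) := by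
  by_cases hα : ∃ (i : Fin r) (n : ℕ), α i = -(n : ℂ)
  · obtain ⟨i, n, hi⟩ := hα
    refine summable_of_ne_finset_zero (s := Finset.range (n + 1)) fun k hk => ?_
    have hk' : n < k := by simpa using hk
    rw [Finset.prod_eq_zero (Finset.mem_univ i) (by rw [hi, poch_neg_natCast_eq_zero hk'])]
    simp
  · have hre' := fun h => (hre h).resolve_right hα
    push Not at hα
    -- Here `Δ* = s - r` and `δ* = 1`. When `r = s + 1`, the term `(r-s)/2 = 1/2` in `μ*` cancels
    -- the threshold `1/2`.
    have hcond : FoxWrightConditions υ α (fun _ => 1) β (fun _ => 1) := by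
      refine ⟨fun i hi => absurd hi (by norm_num), ?_⟩
      have hD : fwDelta (fun _ : Fin r => 1) (fun _ : Fin s => 1) = (s : ℝ) - r := by
        simp [fwDelta]
      have hR : fwRadius (fun _ : Fin r => 1) (fun _ : Fin s => 1) = 1 := by simp [fwRadius]
      rw [hD, hR]
      rcases hrs.lt_or_eq with h | h
      · left
        have : (r : ℝ) < s + 1 := by exact_mod_cast h
        linarith
      · right; right
        have h1 := hre' h
        have h2 : (r : ℝ) = s + 1 := by exact_mod_cast h
        refine ⟨by linarith, rfl, ?_⟩
        simp only [Complex.add_re, Complex.sub_re, Complex.mul_re, Complex.re_ofNat,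
          Complex.im_ofNat, zero_mul, sub_zero] at h1
        have h3 : (((r : ℂ) - s) / 2).re = 1 / 2 := by
          rw [h]; push_cast; simp
        rw [fwMu, Complex.add_re, h3, Complex.sub_re]
        linarith
    have hsum := foxWrightSummable_of_conditions hυ (fun _ => one_ne_zero) (fun _ => one_ne_zero)
      hcond
    have hG : (∏ i, Complex.Gamma (α i)) / (∏ j, Complex.Gamma (β j)) ≠ 0 :=
      div_ne_zero (Finset.prod_ne_zero_iff.2 fun i _ => Complex.Gamma_ne_zero (hα i))
        (Finset.prod_ne_zero_iff.2 fun j _ => Complex.Gamma_ne_zero (hβ j))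
    refine (hsum.mul_left
      ‖(∏ i, Complex.Gamma (α i)) / (∏ j, Complex.Gamma (β j))‖⁻¹).congr fun k => ?_
    rw [foxWrightCoeff_one_eq hα hβ, norm_mul, ← mul_assoc, ← mul_div_assoc,
      inv_mul_cancel_left₀ (norm_ne_zero_iff.2 hG), ← div_div, norm_div _ (k.factorial : ℂ),
      Complex.norm_natCast]

/-! ### Assembly of the formulas. -/

theorem mainTheorem2 (υ : ℂ) (b c lam y : ℝ) (hυ : 0 < υ.re) (hc : 0 < c) (hy : 0 < y)
    (hlb : (0 < lam ∧ 0 < b) ∨ (lam < 0 ∧ b < 0)) :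
    -- all the `₂F₃` series that occur converge everywhere
    (∀ (j : Fin 4) (z : ℂ),
      Summable (pFqTerm (deltaArray 2 ((2 * υ + ((j : ℕ) : ℂ)) / 2)) (deltaStar 3 j) z)) ∧
    -- the formula for `J_C`
    (∀ (r s : ℕ) (α : Fin r → ℂ) (A : Fin r → ℝ) (β : Fin s → ℂ) (B : Fin s → ℝ),
      (∀ i, A i ≠ 0) → (∀ j, B j ≠ 0) → GammaDefined α A → GammaDefined β B →
      (FoxWrightConditions υ α A β B ∨ FoxWrightSummable υ α A β B) →
      (∀ x : ℝ, 0 < x → Summable (foxWrightTerm α A β B (Real.exp (-c * √x) : ℂ))) ∧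
      MeasureTheory.IntegrableOn (integrandJ α A β B υ b c lam y) (Set.Ioi 0) ∧
      Summable (seriesTermJ α A β B υ b c lam y) ∧
      integralJ α A β B υ b c lam y =
        (y : ℂ) ^ (-υ) * ∑' k : ℕ, seriesTermJ α A β B υ b c lam y k) ∧
    -- the formula for `K_C`
    (∀ (r s : ℕ) (α : Fin r → ℂ) (β : Fin s → ℂ),
      (∀ (j : Fin s) (n : ℕ), β j ≠ -(n : ℂ)) → r ≤ s + 1 →
      (r = s + 1 →
        0 < (2 * υ + (∑ j, β j - ∑ i, α i)).re ∨ ∃ (i : Fin r) (n : ℕ), α i = -(n : ℂ)) →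
      (∀ x : ℝ, 0 < x → Summable (pFqTerm α β (Real.exp (-c * √x) : ℂ))) ∧
      MeasureTheory.IntegrableOn (integrandK α β υ b c lam y) (Set.Ioi 0) ∧
      Summable (seriesTermK α β υ b c lam y) ∧
      integralK α β υ b c lam y =
        (y : ℂ) ^ (-υ) * ∑' k : ℕ, seriesTermK α β υ b c lam y k) ∧
    -- `K_C` is, up to the Gamma factor, the case `Aᵢ = Bⱼ = 1` of `J_C`
    (∀ (r s : ℕ) (α : Fin r → ℂ) (β : Fin s → ℂ),
      (∀ (i : Fin r) (n : ℕ), α i ≠ -(n : ℂ)) → (∀ (j : Fin s) (n : ℕ), β j ≠ -(n : ℂ)) →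
      integralJ α (fun _ => 1) β (fun _ => 1) υ b c lam y =
        (∏ i, Complex.Gamma (α i)) / (∏ j, Complex.Gamma (β j)) *
          integralK α β υ b c lam y) := by

  have hlb' : 0 < lam * b := by
    rcases hlb with ⟨h1, h2⟩ | ⟨h1, h2⟩
    · exact mul_pos h1 h2
    · exact mul_pos_of_neg_of_neg h1 h2
  refine ⟨fun j z => summable_pFqTerm_deltaStar hυ j z, ?_, ?_, ?_⟩
  · intro r s α A β B hA hB _ _ hcond
    have hsum : FoxWrightSummable υ α A β B :=
      hcond.elim (foxWrightSummable_of_conditions hυ hA hB) id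
    have hθ : Summable fun k : ℕ => ‖foxWrightCoeff α A β B k / (k.factorial : ℂ)‖ *
        ((k : ℝ) + 1) ^ (-2 * υ.re) :=
      Summable.congr hsum fun k => by rw [norm_div, Complex.norm_natCast]
    have hterm : ∀ (z : ℂ) (k : ℕ), foxWrightTerm α A β B z k =
        foxWrightCoeff α A β B k / (k.factorial : ℂ) * z ^ k := fun z k => by
      rw [foxWrightTerm]; ring
    have h := integral_tsum_mul_exp_sqrt hυ hc hy hlb' hθ
    simp only [← hterm] at h
    exact h
  · intro r s α β hβ hrs hre
    have hterm : ∀ (z : ℂ) (k : ℕ), pFqTerm α β z k =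
        (∏ i, poch (α i) k) / ((∏ j, poch (β j) k) * (k.factorial : ℂ)) * z ^ k := fun z k => by
      rw [pFqTerm, ← div_div]; ring
    have h := integral_tsum_mul_exp_sqrt hυ hc hy hlb' (summable_pFq_coeff hυ hβ hrs hre)
    simp only [← hterm] at h
    exact h
  · intro r s α β hα hβ
    exact integralJ_one_eq hα hβ υ b c lam y
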